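/- Let $d\ge1$, let $(\Omega,\mathcal A,\mathbb P)$ be a probability space, and let $A:\mathbb R^d\times\Omega\to\mathbb R$ be a jointly measurable random field that is stationary, i.e. for every $z\in\mathbb R^d$ the field $A(\cdot+z)$ has the same finite-dimensional distributions as $A$. For $S\subset\mathbb R^d$ let $\sigma(A|_S)$ be the $\sigma$-algebra generated by $(A(x))_{x\in S}$, and write $B_\ell(x)$ for the Euclidean ball of radius $\ell$ centered at $x$ and $B_\ell=B_\ell(0)$. For $\ell\ge0$ and $D\ge0$ let $$\tilde\alpha(\ell,D;A):=\sup\big|\mathbb P[G_1\cap G_2]-\mathbb P[G_1]\,\mathbb P[G_2]\big|,$$ the supremum running over all $G_1\in\sigma(A|_{S_1})$, $G_2\in\sigma(A|_{S_2})$ and all Borel sets $S_1,S_2\subset\mathbb R^d$ with diameters at most $D$ and with distance $d(S_1,S_2)\ge\ell$. For a random variable $X$ let $\mathcal M[X\|\mathcal G]$ be its conditional essential supremum given a $\sigma$-algebra $\mathcal G$ (the least $\mathcal G$-measurable, possibly infinite, almost sure upper bound of $X$), and let $$\partial^{\mathrm{osc}}_{A,S}X:=\mathcal M\big[X\,\|\,\sigma(A|_{\mathbb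 R^d\setminus S})\big]+\mathcal M\big[-X\,\|\,\sigma(A|_{\mathbb R^d\setminus S})\big].$$ Let $\beta>0$ and $K>0$, and assume that at least one of the following holds: (a) ($\alpha$-mixing) $\tilde\alpha(\ell,D;A)\le K(1+D)^K\exp(-\frac1K\ell^\beta)$ for all $\ell,D\ge0$; (b) (multiscale covariance inequality with derivative $\partial^{\mathrm{osc}}$) there is an integrable $\pi:[0,\infty)\to[0,\infty)$ with $\pi(\ell)\le K\exp(-\frac1K\ell^\beta)$ for all $\ell\ge0$ such that for all square-integrable $\sigma(A)$-measurable random variables $X,Y$, $$\operatorname{Cov}[X;Y]\le\int_0^\infty\int_{\mathbb R^d}\mathbb E\big[(\partial^{\mathrm{osc}}_{A,B_{\ell+1}(x)}X)^2\big]^{\frac12}\,\mathbb E\big[(\partial^{\mathrm{osc}}_{A,B_{\ell+1}(x)}Y)^2\big]^{\frac12}\,dx\,(\ell+1)^{-d}\pi(\ell)\,d\ell .$$ Let $f:\mathbb R^{\mathbb R^d}\to\mathbb R$ be measurable for the cylindrical $\sigma$-algebra, and assume that, for some deterministic constants $M$ and $\kappa>0$, $|f(A)|\le M$ almost surely and $f(A)$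 is approximately local in the sense that for all $\ell\ge0$, almost surely, $$\big|f(A)-\mathbb E[f(A)\,\|\,\sigma(A|_{B_\ell})]\big|\le\kappa e^{-\ell/\kappa}.$$ Set $F(x):=f(A(\cdot+x))$, denote by $\mathbb E[F]$ the expectation of $F(x)$ (which does not depend on $x$), and for $L\ge1$ let $$X_L:=L^{-d}\int_{\mathbb R^d}e^{-\frac1L|y|}\,(F(y)-\mathbb E[F])\,dy .$$ Then there is a constant $C>0$ depending only on $d,\beta,K,\kappa,M$ such that for all $\delta>0$ and $L\ge1$, $$\mathbb P[X_L>\delta]\le C\exp\Big(-\tfrac1C\,\delta^2\,(|\log\delta|+1)^{-\frac{d\beta}{d+\beta}}\,L^{\frac{d\beta}{d+\beta}}\Big).$$ -/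

import Mathlib

open MeasureTheory ProbabilityTheory Set
open scoped ENNReal

noncomputable section

namespace RandomField

/-! ### Conditional essential supremum -/

/-- `Z` is a version of the conditional essential supremum of `X` given the σ-algebra `m`:
the least `m`-measurable (extended real valued) almost sure upper bound of `X`. -/
structure IsCondEssSup {Ω : Type*} {m0 : MeasurableSpace Ω} (P : Measure Ω)
    (m : MeasurableSpace Ω) (X : Ω → ℝ) (Z : Ω → EReal) : Prop where
  measurable : Measurable[m] Z
  le : ∀ᵐ ω ∂P, (X ω : EReal) ≤ Z ω
  least : ∀ W : Ω → EReal, Measurable[m] W → (∀ᵐ ω ∂P, (X ω : EReal) ≤ W ω) →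
    ∀ᵐ ω ∂P, Z ω ≤ W ω

/-- The conditional essential supremum of `X` given `m`, as the supremum of the rationals `q`
such that `ℙ[X > q | m] > 0`. It is the object characterized by `IsCondEssSup`,
see `isCondEssSup_condEssSup`. -/
def condEssSup {Ω : Type*} {m0 : MeasurableSpace Ω} (P : Measure Ω)
    (m : MeasurableSpace Ω) (X : Ω → ℝ) (ω : Ω) : EReal :=
  ⨆ (q : ℚ) (_ : 0 < (P[{ω' | (q : ℝ) < X ω'}.indicator (fun _ => (1 : ℝ)) | m]) ω),
    ((q : ℝ) : EReal)

theorem isCondEssSup_condEssSup {Ω : Type*} {m m0 : MeasurableSpace Ω} (P : Measure Ω)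
    [IsProbabilityMeasure P] (hm : m ≤ m0) {X : Ω → ℝ}
    (hX : Measurable X) : IsCondEssSup P m X (condEssSup P m X) := by
  have hset : ∀ q : ℚ, MeasurableSet {ω' | (q : ℝ) < X ω'} := fun q =>
    measurableSet_lt measurable_const hX
  have hint : ∀ q : ℚ,
      Integrable ({ω' | (q : ℝ) < X ω'}.indicator (fun _ => (1 : ℝ))) P := fun q =>
    (integrable_const 1).indicator (hset q)
  have hpos : ∀ q : ℚ, MeasurableSet[m]
      {ω | 0 < (P[{ω' | (q : ℝ) < X ω'}.indicator (fun _ => (1 : ℝ)) | m]) ω} := fun q =>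
    measurableSet_lt measurable_const stronglyMeasurable_condExp.measurable
  -- on an `m`-measurable set, the conditional probability vanishes iff the event is negligible
  have key : ∀ (q : ℚ) (s : Set Ω), MeasurableSet[m] s →
      ∫ ω in s, (P[{ω' | (q : ℝ) < X ω'}.indicator (fun _ => (1 : ℝ)) | m]) ω ∂P
        = P.real ({ω' | (q : ℝ) < X ω'} ∩ s) := by
    intro q s hs
    rw [setIntegral_condExp hm (hint q) hs, integral_indicator (hset q)]
    simp [measureReal_restrict_apply (hset q)]
  refine ⟨?_, ?_, ?_⟩
  · refine Measurable.iSup fun q => ?_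
    classical
    have : (fun ω => ⨆ (_ : 0 < (P[{ω' | (q : ℝ) < X ω'}.indicator (fun _ => (1 : ℝ)) | m]) ω),
        ((q : ℝ) : EReal)) = fun ω =>
        if 0 < (P[{ω' | (q : ℝ) < X ω'}.indicator (fun _ => (1 : ℝ)) | m]) ω
          then ((q : ℝ) : EReal) else ⊥ := by
      funext ω
      split_ifs with h <;> simp [h]
    rw [this]
    exact Measurable.ite (hpos q) measurable_const measurable_const
  · have h : ∀ᵐ ω ∂P, ∀ q : ℚ, (q : ℝ) < X ω →
        0 < (P[{ω' | (q : ℝ) < X ω'}.indicator (fun _ => (1 : ℝ)) | m]) ω := by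
      rw [ae_all_iff]
      intro q
      have h0 : P.real ({ω' | (q : ℝ) < X ω'} ∩
          {ω | 0 < (P[{ω' | (q : ℝ) < X ω'}.indicator (fun _ => (1 : ℝ)) | m]) ω}ᶜ) ≤ 0 := by
        rw [← key q _ (hpos q).compl]
        refine setIntegral_nonpos (hm _ (hpos q).compl) fun ω hω => ?_
        simpa using hω
      have h1 := le_antisymm h0 measureReal_nonneg
      rw [measureReal_eq_zero_iff] at h1
      rw [ae_iff]
      convert h1 using 2
      ext ω
      simp
    filter_upwards [h] with ω hω
    refine le_of_forall_lt fun a ha => ?_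
    obtain ⟨q, haq, hq⟩ := EReal.lt_iff_exists_rat_btwn.1 ha
    refine haq.trans_le ?_
    exact le_iSup₂_of_le q (hω q (by exact_mod_cast hq)) le_rfl
  · intro W hW hle
    have h : ∀ᵐ ω ∂P, ∀ q : ℚ, W ω < ((q : ℝ) : EReal) →
        (P[{ω' | (q : ℝ) < X ω'}.indicator (fun _ => (1 : ℝ)) | m]) ω = 0 := by
      rw [ae_all_iff]
      intro q
      have hs : MeasurableSet[m] {ω | W ω < ((q : ℝ) : EReal)} :=
        measurableSet_lt hW measurable_const
      have h0 : P.real ({ω' | (q : ℝ) < X ω'} ∩ {ω | W ω < ((q : ℝ) : EReal)}) = 0 := by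
        rw [measureReal_eq_zero_iff]
        refine measure_mono_null (fun ω hω => ?_) (ae_iff.1 hle)
        simp only [mem_inter_iff, mem_ofPred_eq] at hω
        simp only [mem_ofPred_eq, not_le]
        exact hω.2.trans (by exact_mod_cast hω.1)
      rw [← key q _ hs] at h0
      have hnn : 0 ≤ᵐ[P] P[{ω' | (q : ℝ) < X ω'}.indicator (fun _ => (1 : ℝ)) | m] :=
        condExp_nonneg (Filter.Eventually.of_forall fun ω =>
          indicator_nonneg (fun _ _ => zero_le_one) ω)
      rw [setIntegral_eq_zero_iff_of_nonneg_ae (ae_restrict_of_ae hnn)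
        integrable_condExp.integrableOn, Filter.EventuallyEq,
        ae_restrict_iff' (hm _ hs)] at h0
      exact h0
    filter_upwards [h] with ω hω
    refine iSup₂_le fun q hq => ?_
    by_contra hlt
    exact hq.ne' (hω q (not_le.1 hlt))

/-! ### Random fields on `ℝ^d` -/

/-- The σ-algebra `σ(A|_S)` generated by the restriction of the field `A` to `S`. -/
abbrev sigmaRestrict {d : ℕ} {Ω : Type*} (A : EuclideanSpace ℝ (Fin d) → Ω → ℝ)
    (S : Set (EuclideanSpace ℝ (Fin d))) : MeasurableSpace Ω :=
  ⨆ x ∈ S, MeasurableSpace.comap (A x) inferInstance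

/-- Stationarity: for every `z`, the translated field `A(· + z)` has the same
finite-dimensional distributions as `A`. -/
def IsStationary {d : ℕ} {Ω : Type*} [MeasurableSpace Ω] (P : Measure Ω)
    (A : EuclideanSpace ℝ (Fin d) → Ω → ℝ) : Prop :=
  ∀ (z : EuclideanSpace ℝ (Fin d)) (I : Finset (EuclideanSpace ℝ (Fin d))),
    P.map (fun ω (x : I) => A (x + z) ω) = P.map (fun ω (x : I) => A x ω)

/-- Rosenblatt's `α`-mixing coefficient between two σ-algebras. -/
def alphaCoeff {Ω : Type*} {m0 : MeasurableSpace Ω} (P : Measure Ω)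
    (m₁ m₂ : MeasurableSpace Ω) : ℝ :=
  sSup {r : ℝ | ∃ G₁ G₂ : Set Ω, MeasurableSet[m₁] G₁ ∧ MeasurableSet[m₂] G₂ ∧
    r = |P.real (G₁ ∩ G₂) - P.real G₁ * P.real G₂|}

/-- The `α`-mixing coefficient of the field `A` at distance `R` and diameter `D`: the supremum of
the coefficients of `σ(A|_{S₁})` and `σ(A|_{S₂})` over Borel sets `S₁, S₂` of diameter at most `D`
and at distance at least `R`. -/
def alphaMixingCoeff {d : ℕ} {Ω : Type*} [MeasurableSpace Ω] (P : Measure Ω)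
    (A : EuclideanSpace ℝ (Fin d) → Ω → ℝ) (R : ℝ) (D : ℝ≥0∞) : ℝ :=
  sSup {r : ℝ | ∃ S₁ S₂ : Set (EuclideanSpace ℝ (Fin d)),
    MeasurableSet S₁ ∧ MeasurableSet S₂ ∧
    (∀ x ∈ S₁, ∀ y ∈ S₂, R ≤ dist x y) ∧ Metric.ediam S₁ ≤ D ∧ Metric.ediam S₂ ≤ D ∧
    r = alphaCoeff P (sigmaRestrict A S₁) (sigmaRestrict A S₂)}

/-- The oscillation `∂^osc_{A,S} X` of a random variable `X` with respect to the restriction of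
the field `A` to `S`: with `𝓜` the conditional essential supremum given `A|_{ℝ^d ∖ S}`, it is
`𝓜[X] + 𝓜[-X]`, almost surely an element of `[0, ∞]`. -/
def osc {d : ℕ} {Ω : Type*} [MeasurableSpace Ω] (P : Measure Ω)
    (A : EuclideanSpace ℝ (Fin d) → Ω → ℝ) (S : Set (EuclideanSpace ℝ (Fin d)))
    (X : Ω → ℝ) (ω : Ω) : ℝ≥0∞ :=
  (condEssSup P (sigmaRestrict A Sᶜ) X ω
    + condEssSup P (sigmaRestrict A Sᶜ) (fun ω' => -X ω') ω).toENNReal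

/-- The multiscale covariance inequality with derivative `∂^osc` and integrable weight `π ≥ 0`,
for all `σ(A)`-measurable (square-integrable, so that the covariance makes sense) random
variables. -/
structure OscMCI {d : ℕ} {Ω : Type*} [MeasurableSpace Ω] (P : Measure Ω)
    (A : EuclideanSpace ℝ (Fin d) → Ω → ℝ) (π : ℝ → ℝ) : Prop where
  weight_nonneg : ∀ l : ℝ, 0 ≤ l → 0 ≤ π l
  weight_integrable : IntegrableOn π (Ioi 0)
  covariance_le : ∀ X Y : Ω → ℝ,
    Measurable[sigmaRestrict A univ] X → Measurable[sigmaRestrict A univ] Y →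
    MemLp X 2 P → MemLp Y 2 P →
    ENNReal.ofReal (covariance X Y P) ≤
      ∫⁻ l in Ioi (0 : ℝ), ∫⁻ x : EuclideanSpace ℝ (Fin d),
        (∫⁻ ω, osc P A (Metric.ball x (l + 1)) X ω ^ 2 ∂P) ^ (1 / 2 : ℝ) *
        (∫⁻ ω, osc P A (Metric.ball x (l + 1)) Y ω ^ 2 ∂P) ^ (1 / 2 : ℝ) *
        ENNReal.ofReal (((l + 1) ^ d)⁻¹ * π l)

/-- The random field `F(x) = f(A(· + x))`. -/
def shiftField {d : ℕ} {Ω : Type*} (A : EuclideanSpace ℝ (Fin d) → Ω → ℝ)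
    (f : (EuclideanSpace ℝ (Fin d) → ℝ) → ℝ) (x : EuclideanSpace ℝ (Fin d)) (ω : Ω) : ℝ :=
  f (fun y => A (y + x) ω)

/-- The spatial average `X_L = L^{-d} ∫ exp(-|y|/L) (F(y) - 𝔼[F]) dy`, with `F(y) = f(A(· + y))`
and `𝔼[F] = 𝔼[F(0)]`. -/
def spatialAverage {d : ℕ} {Ω : Type*} [MeasurableSpace Ω] (P : Measure Ω)
    (A : EuclideanSpace ℝ (Fin d) → Ω → ℝ) (f : (EuclideanSpace ℝ (Fin d) → ℝ) → ℝ)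
    (L : ℝ) (ω : Ω) : ℝ :=
  (L ^ d)⁻¹ * ∫ y : EuclideanSpace ℝ (Fin d),
    Real.exp (-‖y‖ / L) * (shiftField A f y ω - ∫ ω', shiftField A f 0 ω' ∂P)

end RandomField

end

/-!
The proof has two steps.

*Reduction to mixing.* Test the multiscale covariance inequality on the indicators of events
`G₁ ∈ σ(A|_{S₁})` and `G₂ ∈ σ(A|_{S₂})`. The oscillation of `1_{Gᵢ}` on a ball is at most `1`, and
vanishes when the ball does not meet `Sᵢ`. If the sets are at distance `l`, then only balls of
radius at least `l / 2` contribute, and the stretched exponential weight gives `α`-mixing with a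
stretched exponential rate of the same exponent `β` (`exists_alphaMixingCoeff_le_of_oscMCI`). It
remains to treat the mixing case.

*Blocks of size `R`.* By approximate locality and stationarity, `F(y)` is close to a bounded
function `G(y) = g(A(· + y))` of the field in the ball of radius `R / 4` around `y`
(`exists_local_approx`). The average of `G` over a large box is an average, over `u` in the cube
`[0, R)^d`, of weighted sums of `G` over the finite part `u + R z` of a shifted lattice. Jensen's
inequality in `u` therefore bounds the exponential moment of the spatial average by those of the
lattice sums (`measure_lt_localAverage_le`); in this way only the field at lattice sites enters,
and no measurability of partial integrals of `A` with respect to the σ-algebras `σ(A|_S)` is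
needed. For a fixed `u` the summands see the field in balls at mutual distance `R / 2`, so mixing
factorizes the exponential moment up to an error (`lintegral_prod_le_of_mixing`), and Hoeffding's
lemma bounds the factors. With `N` the polynomially large number of sites, `l` the parameter of the
exponential moment and constants omitted, this gives the bound
`exp(-l δ) * (exp(l² (R/L)^d) + N * exp(-R^β + l))`.

The choices are `l ∼ δ (L/R)^d` and `R ∼ ℓ^(β/(d+β)) L^(d/(d+β))` with `ℓ = |log δ| + 1`. Then
`R^β` dominates `l`, the localization error `exp(-R)` is below `δ` since `R ≥ ℓ`, and
`δ² (L/R)^d` is the exponent in the claim (`exists_scale`, `chernoff_optimize`). The choice needs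
`ℓ ≲ L` and a bounded `δ`; for `L ≲ ℓ` the claim holds because its exponent is bounded, and for
large `δ` because `X_L` is bounded.
-/

open MeasureTheory ProbabilityTheory Set
open scoped ENNReal

noncomputable section

namespace RandomField

/-! ### Products of mixing random variables -/

/-- Layer cake: an inequality `μ G ≤ k * ν G + α` on the sets of a σ-algebra passes to bounded
functions measurable with respect to it. -/
theorem lintegral_le_of_forall_measure_le {Ω : Type*} {m m0 : MeasurableSpace Ω} (hm : m ≤ m0)
    {μ ν : Measure Ω} {k α a : ℝ≥0∞} (ha : a ≠ ∞)
    (h : ∀ G, MeasurableSet[m] G → μ G ≤ k * ν G + α)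
    {V : Ω → ℝ≥0∞} (hV : Measurable[m] V) (hVa : ∀ ω, V ω ≤ a) :
    ∫⁻ ω, V ω ∂μ ≤ k * ∫⁻ ω, V ω ∂ν + α * a := by
  have hV' : Measurable[m] fun ω => (V ω).toReal := hV.ennreal_toReal
  have hfin : ∀ ω, V ω ≠ ∞ := fun ω => ((hVa ω).trans_lt ha.lt_top).ne
  have key : ∀ μ : Measure Ω, ∫⁻ ω, V ω ∂μ
      = ∫⁻ t in Ioc 0 a.toReal, μ {ω | t < (V ω).toReal} := by
    intro μ
    have h1 : ∫⁻ ω, V ω ∂μ = ∫⁻ ω, ENNReal.ofReal (V ω).toReal ∂μ :=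
      lintegral_congr fun ω => (ENNReal.ofReal_toReal (hfin ω)).symm
    rw [h1, lintegral_eq_lintegral_meas_lt μ (Filter.Eventually.of_forall fun ω => by simp)
      (hV'.mono hm le_rfl).aemeasurable, ← Ioc_union_Ioi_eq_Ioi (ENNReal.toReal_nonneg (a := a)),
      lintegral_union measurableSet_Ioi (Ioc_disjoint_Ioi le_rfl)]
    have h0 : ∫⁻ t in Ioi a.toReal, μ {ω | t < (V ω).toReal} = 0 := by
      rw [setLIntegral_congr_fun measurableSet_Ioi (g := fun _ => 0)]
      · simp
      · intro t ht
        have : {ω | t < (V ω).toReal} = ∅ := by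
          ext ω
          simpa using (ENNReal.toReal_mono ha (hVa ω)).trans (le_of_lt ht)
        simp [this]
    rw [h0, add_zero]
  have hanti : Measurable fun t : ℝ => ν {ω | t < (V ω).toReal} :=
    Antitone.measurable fun s t hst => measure_mono fun ω hω => hst.trans_lt hω
  rw [key μ, key ν, ← lintegral_const_mul _ hanti]
  calc ∫⁻ t in Ioc 0 a.toReal, μ {ω | t < (V ω).toReal}
      ≤ ∫⁻ t in Ioc 0 a.toReal, (k * ν {ω | t < (V ω).toReal} + α) :=
        lintegral_mono fun t => h _ (measurableSet_lt measurable_const hV')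
    _ = _ := by
        rw [lintegral_add_right _ measurable_const, setLIntegral_const, Real.volume_Ioc, sub_zero,
          ENNReal.ofReal_toReal ha]

/-- The covariance inequality for bounded random variables under `α`-mixing. -/
theorem lintegral_mul_le_of_mixing {Ω : Type*} {m₁ m₂ m0 : MeasurableSpace Ω} {P : Measure Ω}
    (hm₁ : m₁ ≤ m0) (hm₂ : m₂ ≤ m0) {α a b : ℝ≥0∞} (ha : a ≠ ∞) (hb : b ≠ ∞)
    (h : ∀ G₁ G₂, MeasurableSet[m₁] G₁ → MeasurableSet[m₂] G₂ →
      P (G₁ ∩ G₂) ≤ P G₁ * P G₂ + α)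
    {V W : Ω → ℝ≥0∞} (hV : Measurable[m₁] V) (hW : Measurable[m₂] W)
    (hVa : ∀ ω, V ω ≤ a) (hWb : ∀ ω, W ω ≤ b) :
    ∫⁻ ω, V ω * W ω ∂P ≤ (∫⁻ ω, V ω ∂P) * ∫⁻ ω, W ω ∂P + α * (a * b) := by
  have h1 : ∀ G, MeasurableSet[m₂] G →
      (P.withDensity V) G ≤ (∫⁻ ω, V ω ∂P) * P G + α * a := by
    intro G hG
    rw [withDensity_apply _ (hm₂ _ hG), mul_comm (∫⁻ ω, V ω ∂P)]
    refine lintegral_le_of_forall_measure_le hm₁ ha (fun G₁ hG₁ => ?_) hV hVa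
    rw [Measure.restrict_apply (hm₁ _ hG₁), mul_comm]
    exact h _ _ hG₁ hG
  have h2 := lintegral_le_of_forall_measure_le hm₂ hb h1 hW hWb
  rw [lintegral_withDensity_eq_lintegral_mul _ (hV.mono hm₁ le_rfl) (hW.mono hm₂ le_rfl)] at h2
  rw [← mul_assoc]
  exact h2

/-- The expectation of a product of bounded random variables factorizes up to an error, if each
factor is `α`-mixing with respect to any family of others. -/
theorem lintegral_prod_le_of_mixing {Ω ι : Type*} {m0 : MeasurableSpace Ω} {P : Measure Ω}
    [IsProbabilityMeasure P] (m : ι → MeasurableSpace Ω) (hm : ∀ i, m i ≤ m0) {α : ℝ≥0∞}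
    {V : ι → Ω → ℝ≥0∞} (hV : ∀ i, Measurable[m i] (V i)) {b : ι → ℝ≥0∞}
    (hVb : ∀ i ω, V i ω ≤ b i) (hb : ∀ i, b i ≠ ∞) (s : Finset ι)
    (h : ∀ i ∈ s, ∀ t ⊆ s, i ∉ t → ∀ G₁ G₂, MeasurableSet[m i] G₁ →
      MeasurableSet[⨆ j ∈ t, m j] G₂ → P (G₁ ∩ G₂) ≤ P G₁ * P G₂ + α) :
    ∫⁻ ω, ∏ i ∈ s, V i ω ∂P
      ≤ ∏ i ∈ s, ∫⁻ ω, V i ω ∂P + s.card * α * ∏ i ∈ s, b i := by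
  classical
  induction s using Finset.induction_on with
  | empty => simp
  | insert i s his ih =>
    have ih' := ih fun j hj t ht => h j (Finset.mem_insert_of_mem hj) t
      (ht.trans (Finset.subset_insert i s))
    have hmeas : Measurable[⨆ j ∈ s, m j] fun ω => ∏ j ∈ s, V j ω :=
      Finset.measurable_fun_prod _ fun j hj =>
        (hV j).mono (le_iSup₂ (f := fun j (_ : j ∈ s) => m j) j hj) le_rfl
    have h1 := lintegral_mul_le_of_mixing (hm i) (iSup₂_le fun j _ => hm j) (hb i)
      (ENNReal.prod_ne_top fun j _ => hb j)
      (h i (Finset.mem_insert_self i s) s (Finset.subset_insert i s) his) (hV i) hmeas (hVb i)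
      (fun ω => Finset.prod_le_prod' fun j _ => hVb j ω)
    have hEV : ∫⁻ ω, V i ω ∂P ≤ b i :=
      (lintegral_mono (hVb i)).trans (by simp)
    simp only [Finset.prod_insert his, Finset.card_insert_of_notMem his]
    calc ∫⁻ ω, V i ω * ∏ j ∈ s, V j ω ∂P
        ≤ _ := h1
      _ ≤ (∫⁻ ω, V i ω ∂P) * (∏ j ∈ s, ∫⁻ ω, V j ω ∂P + s.card * α * ∏ j ∈ s, b j)
            + α * (b i * ∏ j ∈ s, b j) := by gcongr
      _ = (∫⁻ ω, V i ω ∂P) * ∏ j ∈ s, ∫⁻ ω, V j ω ∂P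
            + ((∫⁻ ω, V i ω ∂P) * (s.card * α * ∏ j ∈ s, b j)
            + α * (b i * ∏ j ∈ s, b j)) := by ring
      _ ≤ (∫⁻ ω, V i ω ∂P) * ∏ j ∈ s, ∫⁻ ω, V j ω ∂P
            + (b i * (s.card * α * ∏ j ∈ s, b j)
            + α * (b i * ∏ j ∈ s, b j)) := by gcongr
      _ = _ := by push_cast; ring

/-- Hoeffding's lemma for a random variable with values in `[-M, M]`. -/
theorem lintegral_exp_sub_integral_le {Ω : Type*} {m0 : MeasurableSpace Ω} {P : Measure Ω}
    [IsProbabilityMeasure P] {X : Ω → ℝ} (hX : Measurable X) {M : ℝ} (hM : ∀ ω, |X ω| ≤ M)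
    (s : ℝ) :
    ∫⁻ ω, ENNReal.ofReal (Real.exp (s * (X ω - ∫ ω', X ω' ∂P))) ∂P
      ≤ ENNReal.ofReal (Real.exp (s ^ 2 * M ^ 2 / 2)) := by
  have h := hasSubgaussianMGF_of_mem_Icc (μ := P) hX.aemeasurable
    (Filter.Eventually.of_forall fun ω => abs_le.1 (hM ω))
  rw [← ofReal_integral_eq_lintegral_ofReal (h.integrable_exp_mul s)
    (Filter.Eventually.of_forall fun ω => (Real.exp_pos _).le)]
  refine ENNReal.ofReal_le_ofReal ((h.mgf_le s).trans (Real.exp_le_exp.2 (le_of_eq ?_)))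
  have : ((‖M - -M‖₊ / 2 : NNReal) : ℝ) = |M| := by
    push_cast
    rw [Real.norm_eq_abs, sub_neg_eq_add, ← two_mul, abs_mul]
    norm_num
  push_cast at this ⊢
  rw [this, sq_abs]
  ring

/-! ### Stationary random fields and approximate locality -/

section Fields

variable {d : ℕ} {Ω : Type*} {A : EuclideanSpace ℝ (Fin d) → Ω → ℝ}

theorem measurable_apply_of_joint [MeasurableSpace Ω]
    (hA : Measurable (fun p : EuclideanSpace ℝ (Fin d) × Ω => A p.1 p.2))
    (x : EuclideanSpace ℝ (Fin d)) : Measurable (A x) :=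
  hA.comp measurable_prodMk_left

theorem sigmaRestrict_le [MeasurableSpace Ω] (hA : ∀ x, Measurable (A x)) (S : Set (EuclideanSpace ℝ (Fin d))) :
    sigmaRestrict A S ≤ ‹MeasurableSpace Ω› :=
  iSup₂_le fun x _ => (hA x).comap_le

theorem sigmaRestrict_mono {S T : Set (EuclideanSpace ℝ (Fin d))} (h : S ⊆ T) :
    sigmaRestrict A S ≤ sigmaRestrict A T :=
  biSup_mono h

/-- The random field seen from `y`, jointly measurable in the point and in the randomness. -/
theorem measurable_shift [MeasurableSpace Ω]
    (hA : Measurable (fun p : EuclideanSpace ℝ (Fin d) × Ω => A p.1 p.2)) :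
    Measurable fun (p : EuclideanSpace ℝ (Fin d) × Ω) (x : EuclideanSpace ℝ (Fin d)) =>
      A (x + p.1) p.2 :=
  measurable_pi_lambda _ fun _ =>
    hA.comp ((measurable_const.add measurable_fst).prodMk measurable_snd)

theorem measurable_shift_apply [MeasurableSpace Ω] (hA : ∀ x, Measurable (A x)) (y : EuclideanSpace ℝ (Fin d)) :
    Measurable fun (ω : Ω) (x : EuclideanSpace ℝ (Fin d)) => A (x + y) ω :=
  measurable_pi_lambda _ fun x => hA (x + y)

/-- A stationary field and its translates have the same law on `ℝ^(ℝ^d)`. -/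
theorem IsStationary.map_shift_eq [MeasurableSpace Ω] {P : Measure Ω} [IsProbabilityMeasure P] (hA : ∀ x, Measurable (A x))
    (hs : IsStationary P A) (y : EuclideanSpace ℝ (Fin d)) :
    P.map (fun ω x => A (x + y) ω) = P.map (fun ω x => A x ω) := by
  have hA0 : Measurable fun (ω : Ω) (x : EuclideanSpace ℝ (Fin d)) => A x ω :=
    measurable_pi_lambda _ hA
  have hr : ∀ I : Finset (EuclideanSpace ℝ (Fin d)),
      Measurable (I.restrict (π := fun _ => ℝ)) := fun I =>
    measurable_pi_lambda _ fun _ => measurable_pi_apply _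
  have : ∀ I : Finset (EuclideanSpace ℝ (Fin d)),
      IsFiniteMeasure (P.map (fun ω (x : I) => A x ω)) := fun I => inferInstance
  refine IsProjectiveLimit.unique (P := fun I => P.map (fun ω (x : I) => A x ω)) ?_ ?_
  · intro I
    rw [Measure.map_map (hr I) (measurable_shift_apply hA y)]
    exact hs y I
  · intro I
    rw [Measure.map_map (hr I) hA0]
    rfl

/-- `σ(A|_S)` is the pullback of the σ-algebra of the coordinates in `S`. -/
theorem comap_shift_eq_sigmaRestrict (S : Set (EuclideanSpace ℝ (Fin d))) :
    MeasurableSpace.comap (fun ω x => A x ω)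
      (sigmaRestrict (fun x (φ : EuclideanSpace ℝ (Fin d) → ℝ) => φ x) S) = sigmaRestrict A S := by
  simp only [sigmaRestrict, MeasurableSpace.comap_iSup, MeasurableSpace.comap_comp]
  rfl

/-- A function of the coordinates in a ball around `0`, evaluated at the field seen from `y`,
depends on the field in the ball around `y`. -/
theorem measurable_comp_shift {g : (EuclideanSpace ℝ (Fin d) → ℝ) → ℝ} {r : ℝ}
    (hg : Measurable[sigmaRestrict (fun x (φ : EuclideanSpace ℝ (Fin d) → ℝ) => φ x)
      (Metric.ball 0 r)] g) (y : EuclideanSpace ℝ (Fin d)) :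
    Measurable[sigmaRestrict A (Metric.ball y r)] fun ω => g (fun x => A (x + y) ω) := by
  have h := Measurable.comp hg
    (comap_measurable (m := sigmaRestrict (fun x (φ : EuclideanSpace ℝ (Fin d) → ℝ) => φ x)
      (Metric.ball 0 r)) (fun ω x => A (x + y) ω))
  rw [comap_shift_eq_sigmaRestrict (A := fun x => A (x + y))] at h
  refine h.mono (iSup₂_le fun x hx => ?_) le_rfl
  refine le_iSup₂_of_le (f := fun x (_ : x ∈ Metric.ball y r) =>
    MeasurableSpace.comap (A x) inferInstance) (x + y) ?_ le_rfl
  simpa [Metric.mem_ball, dist_eq_norm] using hx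

/-- Approximate locality at scale `r`, transported to every point by stationarity: the variables
`F(y)` are approximated by bounded functions `g(A(· + y))` of the field in the ball of radius `r`
around `y`. -/
theorem exists_local_approx [MeasurableSpace Ω] {P : Measure Ω} [IsProbabilityMeasure P] (hA : ∀ x, Measurable (A x))
    (hs : IsStationary P A) {f : (EuclideanSpace ℝ (Fin d) → ℝ) → ℝ} (hf : Measurable f)
    {M : ℝ} (hM : 0 ≤ M) (hfM : ∀ᵐ ω ∂P, |f (fun x => A x ω)| ≤ M) {r ε : ℝ}
    (hloc : ∀ᵐ ω ∂P, |f (fun x => A x ω)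
      - (P[fun ω' => f (fun x => A x ω') | sigmaRestrict A (Metric.ball 0 r)]) ω| ≤ ε) :
    ∃ g : (EuclideanSpace ℝ (Fin d) → ℝ) → ℝ,
      Measurable[sigmaRestrict (fun x (φ : EuclideanSpace ℝ (Fin d) → ℝ) => φ x)
        (Metric.ball 0 r)] g ∧ Measurable g ∧ (∀ φ, |g φ| ≤ M) ∧
      ∀ y, ∀ᵐ ω ∂P, |f (fun x => A (x + y) ω)| ≤ M ∧
        |f (fun x => A (x + y) ω) - g (fun x => A (x + y) ω)| ≤ ε := by
  have hA0 : Measurable fun (ω : Ω) (x : EuclideanSpace ℝ (Fin d)) => A x ω :=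
    measurable_pi_lambda _ hA
  have hcond : StronglyMeasurable[sigmaRestrict A (Metric.ball 0 r)]
      (P[fun ω' => f (fun x => A x ω') | sigmaRestrict A (Metric.ball 0 r)]) :=
    stronglyMeasurable_condExp
  rw [← comap_shift_eq_sigmaRestrict] at hcond hloc
  obtain ⟨g, hg, hgeq⟩ := Measurable.exists_eq_measurable_comp (mY :=
    sigmaRestrict (fun x (φ : EuclideanSpace ℝ (Fin d) → ℝ) => φ x) (Metric.ball 0 r))
    hcond.measurable
  rw [hgeq] at hloc
  have hle : sigmaRestrict (fun x (φ : EuclideanSpace ℝ (Fin d) → ℝ) => φ x) (Metric.ball 0 r)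
      ≤ MeasurableSpace.pi := sigmaRestrict_le (fun x => measurable_pi_apply x) _
  have hg' : Measurable[sigmaRestrict (fun x (φ : EuclideanSpace ℝ (Fin d) → ℝ) => φ x)
      (Metric.ball 0 r)] fun φ => max (-M) (min M (g φ)) :=
    measurable_const.max (measurable_const.min hg)
  have hg0 : Measurable fun φ => max (-M) (min M (g φ)) := hg'.mono hle le_rfl
  refine ⟨_, hg', hg0, fun φ => ?_, fun y => ?_⟩
  · rw [abs_le]
    exact ⟨le_max_left _ _, max_le (by linarith) (min_le_left _ _)⟩
  · have hset : MeasurableSet {φ : EuclideanSpace ℝ (Fin d) → ℝ |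
        |f φ| ≤ M ∧ |f φ - max (-M) (min M (g φ))| ≤ ε} :=
      (measurableSet_le hf.abs measurable_const).inter
        (measurableSet_le (hf.sub hg0).abs measurable_const)
    have h0 : ∀ᵐ φ ∂P.map (fun ω x => A x ω), |f φ| ≤ M ∧
        |f φ - max (-M) (min M (g φ))| ≤ ε := by
      rw [ae_map_iff hA0.aemeasurable hset]
      filter_upwards [hfM, hloc] with ω h1 h2
      refine ⟨h1, le_trans ?_ h2⟩
      -- clipping to `[-M, M]` is a contraction that fixes `f(A)`
      have h3 : f (fun x => A x ω) = max (-M) (min M (f (fun x => A x ω))) := by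
        rw [min_eq_right (abs_le.1 h1).2, max_eq_right (abs_le.1 h1).1]
      conv_lhs => rw [h3]
      refine (abs_max_sub_max_le_max _ _ _ _).trans (max_le (by simp) ?_)
      refine (abs_min_sub_min_le_max _ _ _ _).trans (max_le (by simp) le_rfl)
    rw [← hs.map_shift_eq hA y, ae_map_iff (measurable_shift_apply hA y).aemeasurable hset] at h0
    exact h0

/-- The expectation of a function of the field seen from `y` does not depend on `y`. -/
theorem IsStationary.integral_shift_eq [MeasurableSpace Ω] {P : Measure Ω} [IsProbabilityMeasure P] (hA : ∀ x, Measurable (A x))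
    (hs : IsStationary P A) {g : (EuclideanSpace ℝ (Fin d) → ℝ) → ℝ} (hg : Measurable g)
    (y : EuclideanSpace ℝ (Fin d)) :
    ∫ ω, g (fun x => A (x + y) ω) ∂P = ∫ ω, g (fun x => A x ω) ∂P := by
  rw [← integral_map (φ := fun ω x => A (x + y) ω) (measurable_shift_apply hA y).aemeasurable
      hg.aestronglyMeasurable, hs.map_shift_eq hA y,
    integral_map (measurable_pi_lambda _ hA).aemeasurable hg.aestronglyMeasurable]

/-! ### Mixing coefficients -/

theorem abs_measureReal_sub_le_one [MeasurableSpace Ω] {P : Measure Ω} [IsProbabilityMeasure P] (G₁ G₂ : Set Ω) :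
    |P.real (G₁ ∩ G₂) - P.real G₁ * P.real G₂| ≤ 1 := by
  have h1 : P.real G₁ * P.real G₂ ≤ 1 :=
    mul_le_one₀ measureReal_le_one measureReal_nonneg measureReal_le_one
  have h2 : P.real (G₁ ∩ G₂) ≤ 1 := measureReal_le_one
  have h3 : 0 ≤ P.real (G₁ ∩ G₂) := measureReal_nonneg
  have h4 : 0 ≤ P.real G₁ * P.real G₂ := mul_nonneg measureReal_nonneg measureReal_nonneg
  exact abs_le.2 ⟨by linarith, by linarith⟩

theorem abs_sub_le_alphaCoeff {m₁ m₂ m0 : MeasurableSpace Ω} {P : Measure Ω}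
    [IsProbabilityMeasure P]
    {G₁ G₂ : Set Ω} (h₁ : MeasurableSet[m₁] G₁) (h₂ : MeasurableSet[m₂] G₂) :
    |P.real (G₁ ∩ G₂) - P.real G₁ * P.real G₂| ≤ alphaCoeff P m₁ m₂ := by
  refine le_csSup ⟨1, ?_⟩ ⟨G₁, G₂, h₁, h₂, rfl⟩
  rintro r ⟨G₁, G₂, -, -, rfl⟩
  exact abs_measureReal_sub_le_one G₁ G₂

theorem alphaCoeff_le {m₁ m₂ m0 : MeasurableSpace Ω} {P : Measure Ω} {a : ℝ}
    (h : ∀ G₁ G₂, MeasurableSet[m₁] G₁ → MeasurableSet[m₂] G₂ →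
      |P.real (G₁ ∩ G₂) - P.real G₁ * P.real G₂| ≤ a) : alphaCoeff P m₁ m₂ ≤ a := by
  refine csSup_le ⟨_, ∅, ∅, @MeasurableSet.empty _ m₁, @MeasurableSet.empty _ m₂, rfl⟩ ?_
  rintro r ⟨G₁, G₂, h₁, h₂, rfl⟩
  exact h G₁ G₂ h₁ h₂

/-- The mixing coefficient of the field controls the covariance of events on separated sets. -/
theorem measure_inter_le_of_alphaMixingCoeff_le [MeasurableSpace Ω] {P : Measure Ω} [IsProbabilityMeasure P] {l : ℝ} {D : ℝ≥0∞}
    {a : ℝ} (h : alphaMixingCoeff P A l D ≤ a)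
    {S₁ S₂ : Set (EuclideanSpace ℝ (Fin d))} (hS₁ : MeasurableSet S₁) (hS₂ : MeasurableSet S₂)
    (hdist : ∀ x ∈ S₁, ∀ y ∈ S₂, l ≤ dist x y) (hD₁ : Metric.ediam S₁ ≤ D)
    (hD₂ : Metric.ediam S₂ ≤ D) {G₁ G₂ : Set Ω} (h₁ : MeasurableSet[sigmaRestrict A S₁] G₁)
    (h₂ : MeasurableSet[sigmaRestrict A S₂] G₂) :
    P (G₁ ∩ G₂) ≤ P G₁ * P G₂ + ENNReal.ofReal a := by
  have h3 : alphaCoeff P (sigmaRestrict A S₁) (sigmaRestrict A S₂) ≤ alphaMixingCoeff P A l D := by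
    refine le_csSup ⟨1, ?_⟩ ⟨S₁, S₂, hS₁, hS₂, hdist, hD₁, hD₂, rfl⟩
    rintro r ⟨S₁, S₂, -, -, -, -, -, rfl⟩
    exact alphaCoeff_le fun G₁ G₂ _ _ => abs_measureReal_sub_le_one G₁ G₂
  have h4 := (le_abs_self _).trans (((abs_sub_le_alphaCoeff (P := P) h₁ h₂).trans h3).trans h)
  have ha : 0 ≤ a := (abs_nonneg _).trans
    (((abs_sub_le_alphaCoeff (P := P) h₁ h₂).trans h3).trans h)
  have h5 : P.real (G₁ ∩ G₂) ≤ P.real G₁ * P.real G₂ + a := by linarith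
  have h6 := ENNReal.ofReal_le_ofReal h5
  rwa [ENNReal.ofReal_add (mul_nonneg measureReal_nonneg measureReal_nonneg) ha,
    ENNReal.ofReal_mul measureReal_nonneg, ofReal_measureReal, ofReal_measureReal,
    ofReal_measureReal] at h6

end Fields

/-! ### From the multiscale covariance inequality to `α`-mixing -/

theorem condEssSup_le_of_le {Ω : Type*} {m m0 : MeasurableSpace Ω} {P : Measure Ω}
    [IsProbabilityMeasure P] (hm : m ≤ m0) {X : Ω → ℝ} (hX : Measurable X) {c : ℝ}
    (h : ∀ ω, X ω ≤ c) : ∀ᵐ ω ∂P, condEssSup P m X ω ≤ c :=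
  (isCondEssSup_condEssSup P hm hX).least _ measurable_const
    (Filter.Eventually.of_forall fun ω => by exact_mod_cast h ω)

theorem condEssSup_le_self {Ω : Type*} {m m0 : MeasurableSpace Ω} {P : Measure Ω}
    [IsProbabilityMeasure P] (hm : m ≤ m0) {X : Ω → ℝ} (hX : Measurable[m] X) :
    ∀ᵐ ω ∂P, condEssSup P m X ω ≤ X ω :=
  (isCondEssSup_condEssSup P hm (hX.mono hm le_rfl)).least _ hX.coe_real_ereal
    (Filter.Eventually.of_forall fun _ => le_rfl)

/-- The oscillation of the indicator of an event is at most `1`. -/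
theorem lintegral_osc_indicator_le_one {d : ℕ} {Ω : Type*} [MeasurableSpace Ω] {P : Measure Ω}
    [IsProbabilityMeasure P] {A : EuclideanSpace ℝ (Fin d) → Ω → ℝ} (hA : ∀ x, Measurable (A x))
    {G : Set Ω} (hG : MeasurableSet G) (B : Set (EuclideanSpace ℝ (Fin d))) :
    (∫⁻ ω, osc P A B (G.indicator fun _ => 1) ω ^ 2 ∂P) ^ (1 / 2 : ℝ) ≤ 1 := by
  have hX : Measurable (G.indicator fun _ => (1 : ℝ)) := measurable_const.indicator hG
  have hm := sigmaRestrict_le hA Bᶜ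
  have h1 := condEssSup_le_of_le (P := P) hm hX (c := 1) fun ω => by
    by_cases h : ω ∈ G <;> simp [h]
  have h2 := condEssSup_le_of_le (P := P) hm hX.neg (c := 0) fun ω => by
    by_cases h : ω ∈ G <;> simp [h]
  have h3 : ∫⁻ ω, osc P A B (G.indicator fun _ => 1) ω ^ 2 ∂P ≤ ∫⁻ _, 1 ∂P := by
    refine lintegral_mono_ae ?_
    filter_upwards [h1, h2] with ω h1 h2
    refine pow_le_one₀ zero_le ?_
    refine (EReal.toENNReal_le_toENNReal (add_le_add h1 h2)).trans ?_
    rw [← EReal.coe_add, EReal.toENNReal_of_ne_top (EReal.coe_ne_top _)]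
    simp
  refine (ENNReal.rpow_le_rpow h3 (by norm_num)).trans ?_
  simp

/-- The oscillation on `B` of the indicator of an event depending only on `A|_S` vanishes unless
`B` meets `S`. -/
theorem lintegral_osc_indicator_eq_zero {d : ℕ} {Ω : Type*} [MeasurableSpace Ω] {P : Measure Ω}
    [IsProbabilityMeasure P] {A : EuclideanSpace ℝ (Fin d) → Ω → ℝ} (hA : ∀ x, Measurable (A x))
    {S B : Set (EuclideanSpace ℝ (Fin d))} {G : Set Ω} (hG : MeasurableSet[sigmaRestrict A S] G)
    (hne : ¬(B ∩ S).Nonempty) :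
    (∫⁻ ω, osc P A B (G.indicator fun _ => 1) ω ^ 2 ∂P) ^ (1 / 2 : ℝ) = 0 := by
  have hm := sigmaRestrict_le hA Bᶜ
  have hSB : S ⊆ Bᶜ := fun x hx hxB => hne ⟨x, hxB, hx⟩
  have hXm : Measurable[sigmaRestrict A Bᶜ] (G.indicator fun _ => (1 : ℝ)) :=
    Measurable.indicator measurable_const (sigmaRestrict_mono hSB _ hG)
  have h1 := condEssSup_le_self (P := P) hm hXm
  have h2 := condEssSup_le_self (P := P) hm hXm.neg
  have h3 : ∫⁻ ω, osc P A B (G.indicator fun _ => 1) ω ^ 2 ∂P ≤ ∫⁻ _, 0 ∂P := by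
    refine lintegral_mono_ae ?_
    filter_upwards [h1, h2] with ω h1 h2
    have : osc P A B (G.indicator fun _ => 1) ω ≤ 0 := by
      refine (EReal.toENNReal_le_toENNReal (add_le_add h1 h2)).trans ?_
      rw [← EReal.coe_add]
      simp
    simp [nonpos_iff_eq_zero.1 this]
  refine nonpos_iff_eq_zero.1 ((ENNReal.rpow_le_rpow h3 (by norm_num)).trans ?_)
  simp

/-- A stretched exponential at `l ≥ l₀ / 2 - 1` splits into an integrable factor and a stretched
exponential in `l₀`. -/
theorem exp_neg_rpow_div_le {β K l l₀ : ℝ} (hβ : 0 < β) (hK : 0 < K) (hl : 0 < l) (hl₀ : 0 ≤ l₀)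
    (h : l₀ ≤ 2 * (l + 1)) :
    Real.exp (-(l ^ β) / K) ≤ Real.exp (1 / (2 * K)) *
      Real.exp (-(1 / (2 * K * 4 ^ β)) * l₀ ^ β) * Real.exp (-(1 / (2 * K)) * l ^ β) := by
  rw [← Real.exp_add, ← Real.exp_add, Real.exp_le_exp]
  have h1 : l₀ ^ β ≤ 4 ^ β * (1 + l ^ β) := by
    have h4 : l₀ ≤ 4 * max 1 l := by
      rcases le_total 1 l with h | h
      · rw [max_eq_right h]; linarith
      · rw [max_eq_left h]; linarith
    have h5 : (max 1 l) ^ β ≤ 1 + l ^ β := by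
      rcases le_total 1 l with h | h
      · rw [max_eq_right h]; linarith
      · rw [max_eq_left h, Real.one_rpow]
        linarith [Real.rpow_nonneg hl.le β]
    calc l₀ ^ β ≤ (4 * max 1 l) ^ β := Real.rpow_le_rpow hl₀ h4 hβ.le
      _ = 4 ^ β * (max 1 l) ^ β := Real.mul_rpow (by norm_num) (by positivity)
      _ ≤ _ := by gcongr
  have h4 : (0 : ℝ) < 4 ^ β := by positivity
  have h2 : 1 / (2 * K * 4 ^ β) * l₀ ^ β ≤ 1 / (2 * K) * (1 + l ^ β) := by
    calc 1 / (2 * K * 4 ^ β) * l₀ ^ β ≤ 1 / (2 * K * 4 ^ β) * (4 ^ β * (1 + l ^ β)) := by gcongr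
      _ = _ := by field_simp
  have h3 : -(l ^ β) / K = -(1 / (2 * K)) * l ^ β - 1 / (2 * K) * l ^ β := by field_simp; ring
  rw [h3]
  linarith

theorem integrableOn_exp_neg_mul_rpow {β b : ℝ} (hβ : 0 < β) (hb : 0 < b) :
    IntegrableOn (fun l : ℝ => Real.exp (-b * l ^ β)) (Ioi 0) := by
  simpa using integrableOn_rpow_mul_exp_neg_mul_rpow (s := 0) (by norm_num) hβ hb

/-- Testing the multiscale covariance inequality on indicators: only the balls that meet both
`S₁` and `S₂` contribute, and their radius is at least half the distance of these sets. -/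
theorem OscMCI.measureReal_inter_sub_le {d : ℕ} {Ω : Type*} [MeasurableSpace Ω] {P : Measure Ω}
    [IsProbabilityMeasure P] {A : EuclideanSpace ℝ (Fin d) → Ω → ℝ} (hA : ∀ x, Measurable (A x))
    {π : ℝ → ℝ} (h : OscMCI P A π) {β K : ℝ} (hβ : 0 < β) (hK : 0 < K)
    (hπ : ∀ l : ℝ, 0 ≤ l → π l ≤ K * Real.exp (-(l ^ β) / K))
    {l₀ D : ℝ} (hl₀ : 0 ≤ l₀) (hD : 0 ≤ D) {S₁ S₂ : Set (EuclideanSpace ℝ (Fin d))}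
    (hdist : ∀ x ∈ S₁, ∀ y ∈ S₂, l₀ ≤ dist x y) (hD₁ : Metric.ediam S₁ ≤ ENNReal.ofReal D)
    {G₁ G₂ : Set Ω} (h₁ : MeasurableSet[sigmaRestrict A S₁] G₁)
    (h₂ : MeasurableSet[sigmaRestrict A S₂] G₂) :
    P.real (G₁ ∩ G₂) - P.real G₁ * P.real G₂ ≤
      volume.real (Metric.ball (0 : EuclideanSpace ℝ (Fin d)) 1) * K * Real.exp (1 / (2 * K)) *
        (∫ l in Ioi (0 : ℝ), Real.exp (-(1 / (2 * K)) * l ^ β)) *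
        (1 + D) ^ d * Real.exp (-(1 / (2 * K * 4 ^ β)) * l₀ ^ β) := by
  set v := volume.real (Metric.ball (0 : EuclideanSpace ℝ (Fin d)) 1) with hv
  set J := ∫ l in Ioi (0 : ℝ), Real.exp (-(1 / (2 * K)) * l ^ β) with hJ
  set E := Real.exp (-(1 / (2 * K * 4 ^ β)) * l₀ ^ β) with hE
  have hm₁ : MeasurableSet G₁ := sigmaRestrict_le hA S₁ _ h₁
  have hm₂ : MeasurableSet G₂ := sigmaRestrict_le hA S₂ _ h₂
  have hL₁ : MemLp (G₁.indicator fun _ => (1 : ℝ)) 2 P := (memLp_const 1).indicator hm₁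
  have hL₂ : MemLp (G₂.indicator fun _ => (1 : ℝ)) 2 P := (memLp_const 1).indicator hm₂
  have hcov : covariance (G₁.indicator fun _ => (1 : ℝ)) (G₂.indicator fun _ => 1) P
      = P.real (G₁ ∩ G₂) - P.real G₁ * P.real G₂ := by
    rw [covariance_eq_sub hL₁ hL₂]
    have : (G₁.indicator fun _ => (1 : ℝ)) * (G₂.indicator fun _ => 1)
        = (G₁ ∩ G₂).indicator fun _ => 1 := by
      ext ω
      by_cases a : ω ∈ G₁ <;> by_cases b : ω ∈ G₂ <;> simp [a, b]
    rw [this, integral_indicator_const _ hm₁, integral_indicator_const _ hm₂,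
      integral_indicator_const _ (hm₁.inter hm₂)]
    simp
  rw [← hcov]
  have hmci := h.covariance_le (G₁.indicator fun _ => 1) (G₂.indicator fun _ => 1)
    (Measurable.indicator measurable_const (sigmaRestrict_mono (subset_univ _) _ h₁))
    (Measurable.indicator measurable_const (sigmaRestrict_mono (subset_univ _) _ h₂)) hL₁ hL₂
  obtain ⟨p₀, hp₀⟩ : ∃ p₀, ∀ p ∈ S₁, dist p p₀ ≤ D := by
    rcases S₁.eq_empty_or_nonempty with rfl | ⟨p₀, hp⟩
    · exact ⟨0, by simp⟩
    · refine ⟨p₀, fun p hp' => ?_⟩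
      have := (Metric.edist_le_ediam_of_mem hp' hp).trans hD₁
      rwa [edist_dist, ENNReal.ofReal_le_ofReal_iff hD] at this
  have hinner : ∀ l ∈ Ioi (0 : ℝ), ∫⁻ x : EuclideanSpace ℝ (Fin d),
        (∫⁻ ω, osc P A (Metric.ball x (l + 1)) (G₁.indicator fun _ => 1) ω ^ 2 ∂P) ^ (1 / 2 : ℝ) *
        (∫⁻ ω, osc P A (Metric.ball x (l + 1)) (G₂.indicator fun _ => 1) ω ^ 2 ∂P) ^ (1 / 2 : ℝ) *
        ENNReal.ofReal (((l + 1) ^ d)⁻¹ * π l)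
      ≤ ENNReal.ofReal (v * K * Real.exp (1 / (2 * K)) * (1 + D) ^ d * E *
          Real.exp (-(1 / (2 * K)) * l ^ β)) := by
    intro l hl
    have hl : 0 < l := hl
    have hpt : ∀ x : EuclideanSpace ℝ (Fin d),
        (∫⁻ ω, osc P A (Metric.ball x (l + 1)) (G₁.indicator fun _ => 1) ω ^ 2 ∂P) ^ (1 / 2 : ℝ) *
        (∫⁻ ω, osc P A (Metric.ball x (l + 1)) (G₂.indicator fun _ => 1) ω ^ 2 ∂P) ^ (1 / 2 : ℝ) *
        ENNReal.ofReal (((l + 1) ^ d)⁻¹ * π l)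
        ≤ (Metric.ball p₀ (D + (l + 1))).indicator (fun _ => ENNReal.ofReal (((l + 1) ^ d)⁻¹ *
            (K * (Real.exp (1 / (2 * K)) * E * Real.exp (-(1 / (2 * K)) * l ^ β))))) x := by
      intro x
      by_cases b₁ : (Metric.ball x (l + 1) ∩ S₁).Nonempty
      · by_cases b₂ : (Metric.ball x (l + 1) ∩ S₂).Nonempty
        · have a₁ := lintegral_osc_indicator_le_one (P := P) hA hm₁ (Metric.ball x (l + 1))
          have a₂ := lintegral_osc_indicator_le_one (P := P) hA hm₂ (Metric.ball x (l + 1))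
          obtain ⟨p, hpx, hp⟩ := b₁
          obtain ⟨q, hqx, hq⟩ := b₂
          have hx : x ∈ Metric.ball p₀ (D + (l + 1)) := by
            rw [Metric.mem_ball] at hpx ⊢
            have := dist_triangle x p p₀
            rw [dist_comm] at hpx
            linarith [hp₀ p hp]
          have hll : l₀ ≤ 2 * (l + 1) := by
            have := dist_triangle_right p q x
            rw [Metric.mem_ball] at hpx hqx
            linarith [hdist p hp q hq]
          rw [indicator_of_mem hx]
          calc _ ≤ 1 * 1 * ENNReal.ofReal (((l + 1) ^ d)⁻¹ * π l) := by gcongr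
            _ = ENNReal.ofReal (((l + 1) ^ d)⁻¹ * π l) := by simp
            _ ≤ _ := by
              refine ENNReal.ofReal_le_ofReal ?_
              gcongr
              refine (hπ l hl.le).trans ?_
              gcongr
              exact exp_neg_rpow_div_le hβ hK hl hl₀ hll
        · rw [lintegral_osc_indicator_eq_zero hA h₂ b₂]
          simp
      · rw [lintegral_osc_indicator_eq_zero hA h₁ b₁]
        simp
    refine (lintegral_mono hpt).trans ?_
    rw [lintegral_indicator_const measurableSet_ball, Measure.addHaar_ball_of_pos _ _ (by positivity),
      finrank_euclideanSpace_fin, ← ofReal_measureReal (measure_ball_lt_top.ne),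
      ← hv, ← ENNReal.ofReal_mul (by positivity), ← ENNReal.ofReal_mul (by positivity)]
    refine ENNReal.ofReal_le_ofReal ?_
    have h6 : (D + (l + 1)) ^ d ≤ (1 + D) ^ d * (l + 1) ^ d := by
      rw [← mul_pow]
      gcongr
      nlinarith
    have hv0 : 0 ≤ v := measureReal_nonneg
    calc _ = (v * K * Real.exp (1 / (2 * K)) * E * Real.exp (-(1 / (2 * K)) * l ^ β)) *
          (((l + 1) ^ d)⁻¹ * (D + (l + 1)) ^ d) := by ring
      _ ≤ (v * K * Real.exp (1 / (2 * K)) * E * Real.exp (-(1 / (2 * K)) * l ^ β)) *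
          (((l + 1) ^ d)⁻¹ * ((1 + D) ^ d * (l + 1) ^ d)) := by gcongr
      _ = _ := by field_simp
  have hint := integrableOn_exp_neg_mul_rpow hβ (b := 1 / (2 * K)) (by positivity)
  have hv0 : 0 ≤ v := measureReal_nonneg
  have hfin : ENNReal.ofReal (covariance (G₁.indicator fun _ => (1 : ℝ))
      (G₂.indicator fun _ => 1) P) ≤ ENNReal.ofReal
        (v * K * Real.exp (1 / (2 * K)) * (1 + D) ^ d * E * J) := by
    refine (hmci.trans (setLIntegral_mono' measurableSet_Ioi hinner)).trans_eq ?_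
    rw [hJ, ← integral_const_mul, ofReal_integral_eq_lintegral_ofReal (hint.const_mul _)]
    exact Filter.Eventually.of_forall fun l => by positivity
  have hJ0 : 0 ≤ J := integral_nonneg fun l => (Real.exp_pos _).le
  rw [ENNReal.ofReal_le_ofReal_iff (by positivity)] at hfin
  exact hfin.trans_eq (by ring)

/-- The multiscale covariance inequality with a stretched exponential weight implies `α`-mixing
with a stretched exponential rate of the same exponent. -/
theorem exists_alphaMixingCoeff_le_of_oscMCI (d : ℕ) {β K : ℝ} (hβ : 0 < β) (hK : 0 < K) :
    ∃ K' : ℝ, 0 < K' ∧ ∀ (Ω : Type*) [MeasurableSpace Ω] (P : Measure Ω) [IsProbabilityMeasure P]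
      (A : EuclideanSpace ℝ (Fin d) → Ω → ℝ), (∀ x, Measurable (A x)) →
      ∀ π : ℝ → ℝ, (∀ l : ℝ, 0 ≤ l → π l ≤ K * Real.exp (-(l ^ β) / K)) → OscMCI P A π →
      ∀ l D : ℝ, 0 ≤ l → 0 ≤ D → alphaMixingCoeff P A l (ENNReal.ofReal D)
        ≤ K' * (1 + D) ^ K' * Real.exp (-(l ^ β) / K') := by
  set B := volume.real (Metric.ball (0 : EuclideanSpace ℝ (Fin d)) 1) * K *
    Real.exp (1 / (2 * K)) * (∫ l in Ioi (0 : ℝ), Real.exp (-(1 / (2 * K)) * l ^ β)) with hB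
  have hB0 : 0 ≤ B := by
    have : 0 ≤ ∫ l in Ioi (0 : ℝ), Real.exp (-(1 / (2 * K)) * l ^ β) :=
      integral_nonneg fun l => (Real.exp_pos _).le
    positivity
  have hs : (0 : ℝ) < 2 * K * 4 ^ β := by positivity
  refine ⟨B + d + 2 * K * 4 ^ β, by positivity, ?_⟩
  intro Ω _ P _ A hA π hπ h l D hl hD
  refine csSup_le ⟨_, ∅, ∅, MeasurableSet.empty, MeasurableSet.empty, by simp, by simp,
    by simp, rfl⟩ ?_
  rintro r ⟨S₁, S₂, -, -, hdist, hD₁, -, rfl⟩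
  refine alphaCoeff_le fun G₁ G₂ h₁ h₂ => ?_
  have h3 := h.measureReal_inter_sub_le hA hβ hK hπ hl hD hdist hD₁ h₁ h₂
  have h4 := h.measureReal_inter_sub_le hA hβ hK hπ hl hD hdist hD₁ h₁.compl h₂
  have hm₁ : MeasurableSet G₁ := sigmaRestrict_le hA S₁ _ h₁
  -- passing to the complement changes the sign of the covariance
  have h5 : P.real (G₁ᶜ ∩ G₂) = P.real G₂ - P.real (G₁ ∩ G₂) := by
    have := measureReal_inter_add_sdiff (μ := P) (s := G₂) hm₁
    rw [inter_comm G₁ᶜ, ← sdiff_eq, inter_comm G₁]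
    linarith
  rw [h5, probReal_compl_eq_one_sub hm₁] at h4
  have h6 : |P.real (G₁ ∩ G₂) - P.real G₁ * P.real G₂|
      ≤ B * (1 + D) ^ d * Real.exp (-(1 / (2 * K * 4 ^ β)) * l ^ β) :=
    abs_le.2 ⟨by linarith, h3⟩
  refine h6.trans ?_
  have h7 : (1 + D) ^ d ≤ (1 + D) ^ (B + d + 2 * K * 4 ^ β) := by
    rw [← Real.rpow_natCast]
    exact Real.rpow_le_rpow_of_exponent_le (by linarith) (by linarith)
  have h8 : -(1 / (2 * K * 4 ^ β)) * l ^ β ≤ -(l ^ β) / (B + d + 2 * K * 4 ^ β) := by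
    rw [neg_div, neg_mul, neg_le_neg_iff, one_div, ← div_eq_inv_mul]
    have hd : (0 : ℝ) ≤ d := Nat.cast_nonneg d
    exact div_le_div_of_nonneg_left (Real.rpow_nonneg hl _) hs (by linarith)
  have hd : (0 : ℝ) ≤ d := Nat.cast_nonneg d
  gcongr
  linarith

/-! ### Cubes and exponential weights in `ℝ^d` -/

/-- The index of the cube of the grid `R ℤ^d` that contains `y`. -/
def cell {d : ℕ} (R : ℝ) (y : EuclideanSpace ℝ (Fin d)) : Fin d → ℤ := fun i => ⌊y i / R⌋

/-- The point of the lattice `R ℤ^d` with index `z`. -/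
def latticePoint {d : ℕ} (R : ℝ) (z : Fin d → ℤ) : EuclideanSpace ℝ (Fin d) :=
  WithLp.toLp 2 fun i => R * z i

/-- The half-open cube `[0, R)^d`. -/
def cube (d : ℕ) (R : ℝ) : Set (EuclideanSpace ℝ (Fin d)) := {y | cell R y = 0}

section Cubes

variable {d : ℕ} {R L : ℝ}

theorem latticePoint_apply (z : Fin d → ℤ) (i : Fin d) : latticePoint R z i = R * z i := rfl

theorem measurable_cell : Measurable (cell R : EuclideanSpace ℝ (Fin d) → Fin d → ℤ) := by
  refine measurable_pi_lambda _ fun i => Int.measurable_floor.comp ?_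
  fun_prop

theorem cell_add_latticePoint (hR : 0 < R) (u : EuclideanSpace ℝ (Fin d)) (z : Fin d → ℤ) :
    cell R (u + latticePoint R z) = cell R u + z := by
  ext i
  simp only [cell, PiLp.add_apply, latticePoint_apply, Pi.add_apply]
  rw [add_div, mul_div_cancel_left₀ _ hR.ne', Int.floor_add_intCast]

theorem mem_cube_iff (hR : 0 < R) {u : EuclideanSpace ℝ (Fin d)} :
    u ∈ cube d R ↔ ∀ i, u i ∈ Ico 0 R := by
  simp only [cube, cell, mem_ofPred_eq, funext_iff, Pi.zero_apply, Int.floor_eq_zero_iff, mem_Ico]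
  refine forall_congr' fun i => ?_
  rw [div_lt_one hR, le_div_iff₀ hR, zero_mul]

theorem measurableSet_cube : MeasurableSet (cube d R) :=
  measurable_cell (measurableSet_singleton (0 : Fin d → ℤ))

theorem volume_cube (hR : 0 < R) : volume (cube d R) = ENNReal.ofReal (R ^ d) := by
  have h : cube d R = (WithLp.ofLp : EuclideanSpace ℝ (Fin d) → Fin d → ℝ) ⁻¹'
      (pi univ fun _ => Ico 0 R) := by
    ext u
    simp only [mem_cube_iff hR, mem_preimage, mem_univ_pi]
  rw [h, (PiLp.volume_preserving_ofLp (Fin d)).measure_preimage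
    (MeasurableSet.univ_pi fun _ => measurableSet_Ico).nullMeasurableSet, Real.volume_pi_Ico]
  simp [ENNReal.ofReal_pow hR.le]

theorem setIntegral_cell_eq (hR : 0 < R) (h : EuclideanSpace ℝ (Fin d) → ℝ) (z : Fin d → ℤ) :
    ∫ y in cell R ⁻¹' {z}, h y = ∫ u in cube d R, h (u + latticePoint R z) := by
  have hpre : (· + latticePoint R z) ⁻¹' (cell R ⁻¹' {z}) = cube d R := by
    ext u
    simp [cell_add_latticePoint hR, cube]
  rw [← hpre]
  exact ((measurePreserving_add_right volume (latticePoint R z)).setIntegral_preimage_emb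
    (measurableEmbedding_addRight _) h _).symm

/-- Folding an integral over finitely many cubes into an integral over one cube. -/
theorem setIntegral_cell_mem_eq (hR : 0 < R) {h : EuclideanSpace ℝ (Fin d) → ℝ}
    (hh : Integrable h) (s : Finset (Fin d → ℤ)) :
    ∫ y in cell R ⁻¹' s, h y = ∫ u in cube d R, ∑ z ∈ s, h (u + latticePoint R z) := by
  have h1 : cell R ⁻¹' (s : Set (Fin d → ℤ))
      = ⋃ z ∈ s, (cell R ⁻¹' {z} : Set (EuclideanSpace ℝ (Fin d))) := by
    ext y
    simp
  rw [h1, integral_biUnion_finset s (fun z _ => measurable_cell (measurableSet_singleton z)) ?_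
    fun z _ => hh.integrableOn]
  · rw [integral_finsetSum _ fun z _ => (hh.comp_add_right _).integrableOn]
    exact Finset.sum_congr rfl fun z _ => setIntegral_cell_eq hR h z
  · intro z _ z' _ hzz
    exact Disjoint.preimage _ (by simpa using hzz)

theorem norm_le_of_forall_abs_le {x : EuclideanSpace ℝ (Fin d)} {b : ℝ}
    (h : ∀ i, |x i| ≤ b) : ‖x‖ ≤ d * b := by
  have hx : x = ∑ i, EuclideanSpace.single i (x i) := by
    ext j
    simp [Finset.sum_apply, WithLp.ofLp_sum]
  rw [hx]
  refine (norm_sum_le _ _).trans ?_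
  calc ∑ i : Fin d, ‖EuclideanSpace.single i (x i)‖ ≤ ∑ _i : Fin d, b :=
        Finset.sum_le_sum fun i _ => by simpa using h i
    _ = d * b := by simp

theorem norm_sub_le_of_mem_cube (hR : 0 < R) {u v : EuclideanSpace ℝ (Fin d)}
    (hu : u ∈ cube d R) (hv : v ∈ cube d R) : ‖u - v‖ ≤ d * R := by
  rw [mem_cube_iff hR] at hu hv
  refine norm_le_of_forall_abs_le fun i => ?_
  have h1 := hu i
  have h2 := hv i
  rw [PiLp.sub_apply, abs_le]
  exact ⟨by linarith [h1.1, h2.2], by linarith [h1.2, h2.1]⟩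

theorem le_norm_latticePoint_sub (hR : 0 < R) {z z' : Fin d → ℤ} (h : z ≠ z') :
    R ≤ ‖latticePoint R z - latticePoint R z'‖ := by
  obtain ⟨i, hi⟩ := Function.ne_iff.1 h
  refine le_trans ?_ (PiLp.norm_apply_le _ i)
  rw [PiLp.sub_apply, latticePoint_apply, latticePoint_apply, ← mul_sub, norm_mul, Real.norm_eq_abs,
    Real.norm_eq_abs, abs_of_pos hR]
  have h1 : (1 : ℝ) ≤ |((z i - z' i : ℤ) : ℝ)| := by
    rw [← Int.cast_abs]
    exact_mod_cast Int.one_le_abs (sub_ne_zero.2 hi)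
  push_cast at h1
  nlinarith

theorem norm_latticePoint_sub_le (hR : 0 < R) {n : ℕ} {z z' : Fin d → ℤ}
    (hz : z ∈ Finset.Icc (fun _ => -(n : ℤ)) (fun _ => (n : ℤ)))
    (hz' : z' ∈ Finset.Icc (fun _ => -(n : ℤ)) (fun _ => (n : ℤ))) :
    ‖latticePoint R z - latticePoint R z'‖ ≤ d * (R * (2 * n)) := by
  rw [Finset.mem_Icc, Pi.le_def, Pi.le_def] at hz hz'
  refine norm_le_of_forall_abs_le fun i => ?_
  rw [PiLp.sub_apply, latticePoint_apply, latticePoint_apply, ← mul_sub, abs_mul, abs_of_pos hR]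
  gcongr
  have h1 : |z i - z' i| ≤ 2 * n :=
    abs_le.2 ⟨by linarith [hz.1 i, hz'.2 i], by linarith [hz.2 i, hz'.1 i]⟩
  have h2 := (Int.cast_le (R := ℝ)).2 h1
  push_cast at h2
  exact h2

theorem le_norm_of_cell_notMem (hR : 0 < R) {n : ℕ} {y : EuclideanSpace ℝ (Fin d)}
    (h : cell R y ∉ Finset.Icc (fun _ => -(n : ℤ)) (fun _ => (n : ℤ))) : n * R ≤ ‖y‖ := by
  rw [Finset.mem_Icc, Pi.le_def, Pi.le_def, not_and_or, not_forall, not_forall] at h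
  rcases h with ⟨i, hi⟩ | ⟨i, hi⟩
  · refine le_trans ?_ (PiLp.norm_apply_le y i)
    rw [Real.norm_eq_abs]
    refine le_trans ?_ (neg_le_abs _)
    rw [not_le, cell, Int.floor_lt, div_lt_iff₀ hR] at hi
    push_cast at hi
    linarith
  · refine le_trans ?_ (PiLp.norm_apply_le y i)
    rw [Real.norm_eq_abs]
    refine le_trans ?_ (le_abs_self _)
    rw [not_le, cell] at hi
    have := Int.le_floor.1 hi.le
    rw [le_div_iff₀ hR] at this
    exact_mod_cast this

theorem card_Icc_neg_natCast (n : ℕ) :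
    (Finset.Icc (fun _ : Fin d => -(n : ℤ)) (fun _ => (n : ℤ))).card = (2 * n + 1) ^ d := by
  rw [Pi.card_Icc]
  simp only [Int.card_Icc, Finset.prod_const, Finset.card_univ, Fintype.card_fin]
  congr 1
  omega

theorem integrable_exp_neg_norm (hd : 0 < d) :
    Integrable fun y : EuclideanSpace ℝ (Fin d) => Real.exp (-‖y‖) := by
  have : Nonempty (Fin d) := ⟨⟨0, hd⟩⟩
  have h := (integrable_fun_norm_addHaar (volume : Measure (EuclideanSpace ℝ (Fin d)))
    (f := fun t : ℝ => Real.exp (-t))).2 ?_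
  · exact h
  · have h1 := integrableOn_rpow_mul_exp_neg_mul_rpow (p := 1) (s := ((d - 1 : ℕ) : ℝ)) (b := 1)
      (by linarith [Nat.cast_nonneg (α := ℝ) (d - 1)]) one_pos one_pos
    simpa [Real.rpow_natCast] using h1

theorem integrable_exp_neg_norm_div (hd : 0 < d) (hL : 0 < L) :
    Integrable fun y : EuclideanSpace ℝ (Fin d) => Real.exp (-‖y‖ / L) := by
  have h := (integrable_exp_neg_norm hd).comp_smul (inv_ne_zero hL.ne')
  refine h.congr (Filter.Eventually.of_forall fun y => ?_)
  simp only [norm_smul, norm_inv, Real.norm_eq_abs, abs_of_pos hL]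
  rw [neg_div, div_eq_inv_mul]

theorem integral_exp_neg_norm_div (hL : 0 < L) :
    ∫ y : EuclideanSpace ℝ (Fin d), Real.exp (-‖y‖ / L)
      = L ^ d * ∫ y : EuclideanSpace ℝ (Fin d), Real.exp (-‖y‖) := by
  have h := Measure.integral_comp_inv_smul_of_nonneg (volume : Measure (EuclideanSpace ℝ (Fin d)))
    (fun y => Real.exp (-‖y‖)) hL.le
  rw [finrank_euclideanSpace_fin, smul_eq_mul] at h
  rw [← h]
  refine integral_congr_ae (Filter.Eventually.of_forall fun y => ?_)
  simp only [norm_smul, norm_inv, Real.norm_eq_abs, abs_of_pos hL]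
  rw [neg_div, div_eq_inv_mul]

/-- Riemann sums of `exp(-|y|/L)` on the shifted lattice of mesh `R ≤ L` are bounded uniformly in
the shift. -/
theorem sum_exp_neg_norm_div_le (hd : 0 < d) (hR : 0 < R) (hRL : R ≤ L)
    {u : EuclideanSpace ℝ (Fin d)} (hu : u ∈ cube d R) (s : Finset (Fin d → ℤ)) :
    ∑ z ∈ s, (R / L) ^ d * Real.exp (-‖u + latticePoint R z‖ / L)
      ≤ Real.exp d * ∫ y : EuclideanSpace ℝ (Fin d), Real.exp (-‖y‖) := by
  have hL : 0 < L := hR.trans_le hRL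
  have hint := integrable_exp_neg_norm_div (d := d) hd hL
  have hvol : volume.real (cube d R) = R ^ d := by
    rw [measureReal_def, volume_cube hR, ENNReal.toReal_ofReal (by positivity)]
  have h1 : R ^ d * ∑ z ∈ s, Real.exp (-‖u + latticePoint R z‖ / L)
      ≤ Real.exp d * (L ^ d * ∫ y : EuclideanSpace ℝ (Fin d), Real.exp (-‖y‖)) := by
    calc R ^ d * ∑ z ∈ s, Real.exp (-‖u + latticePoint R z‖ / L)
        = ∫ _v in cube d R, ∑ z ∈ s, Real.exp (-‖u + latticePoint R z‖ / L) := by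
          rw [setIntegral_const, hvol, smul_eq_mul]
      _ ≤ ∫ v in cube d R, ∑ z ∈ s, Real.exp d * Real.exp (-‖v + latticePoint R z‖ / L) := by
          refine setIntegral_mono_on ?_ ?_ measurableSet_cube fun v hv => ?_
          · exact integrableOn_const (by simp [volume_cube hR])
          · exact integrable_finsetSum _ fun z _ =>
              ((hint.comp_add_right _).const_mul _).integrableOn
          · refine Finset.sum_le_sum fun z _ => ?_
            rw [← Real.exp_add, Real.exp_le_exp, neg_div, neg_div]
            have h2 := norm_sub_le_of_mem_cube hR hv hu
            have h3 : ‖v + latticePoint R z‖ ≤ d * L + ‖u + latticePoint R z‖ := by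
              have : v + latticePoint R z = (v - u) + (u + latticePoint R z) := by abel
              rw [this]
              refine (norm_add_le _ _).trans ?_
              gcongr
              exact h2.trans (by gcongr)
            have h4 : ‖v + latticePoint R z‖ / L ≤ d + ‖u + latticePoint R z‖ / L := by
              rw [div_le_iff₀ hL, add_mul, div_mul_cancel₀ _ hL.ne']
              exact h3
            linarith
      _ = ∫ y in cell R ⁻¹' (s : Set (Fin d → ℤ)),
            Real.exp d * Real.exp (-‖y‖ / L) :=
          (setIntegral_cell_mem_eq hR (hint.const_mul _) s).symm
      _ ≤ ∫ y : EuclideanSpace ℝ (Fin d), Real.exp d * Real.exp (-‖y‖ / L) :=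
          setIntegral_le_integral (hint.const_mul _)
            (Filter.Eventually.of_forall fun y => by positivity)
      _ = _ := by rw [integral_const_mul, integral_exp_neg_norm_div hL]
  rw [← Finset.mul_sum, div_pow, div_mul_eq_mul_div, div_le_iff₀ (by positivity)]
  linarith

end Cubes

/-! ### Exponential moments of spatial averages -/

theorem abs_integral_le_of_abs_le {Ω : Type*} [MeasurableSpace Ω] {P : Measure Ω}
    [IsProbabilityMeasure P] {X : Ω → ℝ} {M : ℝ} (h : ∀ᵐ ω ∂P, |X ω| ≤ M) :
    |∫ ω, X ω ∂P| ≤ M := by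
  simpa using norm_integral_le_of_norm_le_const (μ := P) (f := X) (C := M) h

/-- Exponential moments of sums of local functions of a stationary mixing field over points at
mutual distance at least `R`: the random variables see the field in disjoint balls of radius `R/4`,
hence behave like independent ones. -/
theorem lintegral_exp_sum_local_le {d : ℕ} {Ω ι : Type*} [MeasurableSpace Ω] {P : Measure Ω}
    [IsProbabilityMeasure P] {A : EuclideanSpace ℝ (Fin d) → Ω → ℝ} (hA : ∀ x, Measurable (A x))
    (hs : IsStationary P A) {g : (EuclideanSpace ℝ (Fin d) → ℝ) → ℝ} {R Δ M a l : ℝ}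
    (hg : Measurable[sigmaRestrict (fun x (φ : EuclideanSpace ℝ (Fin d) → ℝ) => φ x)
      (Metric.ball 0 (R / 4))] g) (hg0 : Measurable g) (hgM : ∀ φ, |g φ| ≤ M)
    (hR : 0 < R) (hΔ : 0 ≤ Δ) (hl : 0 ≤ l)
    (hα : alphaMixingCoeff P A (R / 2) (ENNReal.ofReal (Δ + R)) ≤ a)
    (p : ι → EuclideanSpace ℝ (Fin d)) (s : Finset ι)
    (hsep : ∀ i ∈ s, ∀ j ∈ s, i ≠ j → R ≤ dist (p i) (p j))
    (hdiam : ∀ i ∈ s, ∀ j ∈ s, dist (p i) (p j) ≤ Δ) {w : ι → ℝ} (hw : ∀ i, 0 ≤ w i) :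
    ∫⁻ ω, ENNReal.ofReal (Real.exp (l * ∑ i ∈ s, w i *
        (g (fun x => A (x + p i) ω) - ∫ ω', g (fun x => A x ω') ∂P))) ∂P
      ≤ ENNReal.ofReal (Real.exp (l ^ 2 * M ^ 2 / 2 * ∑ i ∈ s, w i ^ 2))
        + s.card * ENNReal.ofReal a * ENNReal.ofReal (Real.exp (2 * M * l * ∑ i ∈ s, w i)) := by
  set m := ∫ ω', g (fun x => A x ω') ∂P with hm
  have hmM : |m| ≤ M := abs_integral_le_of_abs_le (Filter.Eventually.of_forall fun ω => hgM _)
  let V : ι → Ω → ℝ≥0∞ := fun i ω =>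
    ENNReal.ofReal (Real.exp (l * w i * (g (fun x => A (x + p i) ω) - m)))
  have hV : ∀ i, Measurable[sigmaRestrict A (Metric.ball (p i) (R / 4))] (V i) := fun i =>
    (Real.measurable_exp.comp (((measurable_comp_shift hg (p i)).sub_const m).const_mul
      (l * w i))).ennreal_ofReal
  have hVb : ∀ i ω, V i ω ≤ ENNReal.ofReal (Real.exp (2 * M * l * w i)) := by
    intro i ω
    refine ENNReal.ofReal_le_ofReal (Real.exp_le_exp.2 ?_)
    have h1 : g (fun x => A (x + p i) ω) - m ≤ 2 * M := by
      linarith [(abs_le.1 (hgM fun x => A (x + p i) ω)).2, (abs_le.1 hmM).1]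
    calc l * w i * (g (fun x => A (x + p i) ω) - m) ≤ l * w i * (2 * M) :=
          mul_le_mul_of_nonneg_left h1 (mul_nonneg hl (hw i))
      _ = _ := by ring
  have hVint : ∀ i, ∫⁻ ω, V i ω ∂P
      ≤ ENNReal.ofReal (Real.exp (l ^ 2 * M ^ 2 / 2 * w i ^ 2)) := by
    intro i
    have h := lintegral_exp_sub_integral_le (P := P)
      (hg0.comp (measurable_shift_apply hA (p i))) (fun ω => hgM _) (l * w i)
    simp only [Function.comp_apply] at h
    rw [hs.integral_shift_eq hA hg0 (p i)] at h
    refine h.trans_eq ?_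
    congr 2
    ring
  have hmix := lintegral_prod_le_of_mixing (P := P)
    (fun i => sigmaRestrict A (Metric.ball (p i) (R / 4))) (fun i => sigmaRestrict_le hA _)
    (α := ENNReal.ofReal a) hV hVb (fun i => ENNReal.ofReal_ne_top) s ?_
  · have h1 : ∀ ω, ENNReal.ofReal (Real.exp (l * ∑ i ∈ s, w i *
        (g (fun x => A (x + p i) ω) - m))) = ∏ i ∈ s, V i ω := by
      intro ω
      rw [← ENNReal.ofReal_prod_of_nonneg fun i _ => (Real.exp_pos _).le, ← Real.exp_sum,
        Finset.mul_sum]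
      simp only [mul_assoc]
    simp only [h1]
    refine hmix.trans ?_
    rw [← ENNReal.ofReal_prod_of_nonneg fun i _ => (Real.exp_pos _).le, ← Real.exp_sum,
      ← Finset.mul_sum]
    gcongr
    refine (Finset.prod_le_prod' fun i _ => hVint i).trans_eq ?_
    rw [← ENNReal.ofReal_prod_of_nonneg fun i _ => (Real.exp_pos _).le, ← Real.exp_sum,
      ← Finset.mul_sum]
  · intro i hi t ht hit G₁ G₂ h₁ h₂
    have hle : ⨆ j ∈ t, sigmaRestrict A (Metric.ball (p j) (R / 4))
        ≤ sigmaRestrict A (⋃ j ∈ t, Metric.ball (p j) (R / 4)) :=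
      iSup₂_le fun j hj => sigmaRestrict_mono (subset_biUnion_of_mem (u := fun j =>
        Metric.ball (p j) (R / 4)) hj)
    refine measure_inter_le_of_alphaMixingCoeff_le hα measurableSet_ball
      (Finset.measurableSet_biUnion t fun j _ => measurableSet_ball) ?_ ?_ ?_ h₁ (hle _ h₂)
    · intro x hx y hy
      obtain ⟨j, hj, hyj⟩ := mem_iUnion₂.1 hy
      rw [Metric.mem_ball] at hx hyj
      have h3 := hsep i hi j (ht hj) fun h => hit (h ▸ hj)
      have h4 := dist_triangle4_left (p i) (p j) x y
      have h5 := dist_triangle4 (p i) x y (p j)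
      rw [dist_comm (p i) x] at h5
      linarith
    · refine Metric.ediam_le fun x hx y hy => ?_
      rw [Metric.mem_ball] at hx hy
      rw [edist_dist]
      refine ENNReal.ofReal_le_ofReal ?_
      linarith [dist_triangle_right x y (p i)]
    · refine Metric.ediam_le fun x hx y hy => ?_
      obtain ⟨j, hj, hxj⟩ := mem_iUnion₂.1 hx
      obtain ⟨k, hk, hyk⟩ := mem_iUnion₂.1 hy
      rw [Metric.mem_ball] at hxj hyk
      rw [edist_dist]
      refine ENNReal.ofReal_le_ofReal ?_
      have h5 := dist_triangle4 x (p j) (p k) y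
      rw [dist_comm (p k) y] at h5
      linarith [hdiam j (ht hj) k (ht hk)]

/-- Jensen's inequality for the exponential of an average of bounded functions. -/
theorem ofReal_exp_integral_le {α : Type*} [MeasurableSpace α] {ν : Measure α}
    [IsProbabilityMeasure ν] {Y : α → ℝ} (hY : Measurable Y) {b : ℝ} (hb : ∀ᵐ u ∂ν, |Y u| ≤ b) :
    ENNReal.ofReal (Real.exp (∫ u, Y u ∂ν)) ≤ ∫⁻ u, ENNReal.ofReal (Real.exp (Y u)) ∂ν := by
  have hint1 : Integrable Y ν := Integrable.of_bound hY.aestronglyMeasurable b hb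
  have hint2 : Integrable (fun u => Real.exp (Y u)) ν := by
    refine Integrable.of_bound (Real.measurable_exp.comp hY).aestronglyMeasurable
      (Real.exp b) ?_
    filter_upwards [hb] with u hu
    rw [Real.norm_eq_abs, Real.abs_exp]
    exact Real.exp_le_exp.2 (abs_le.1 hu).2
  rw [← ofReal_integral_eq_lintegral_ofReal hint2
    (Filter.Eventually.of_forall fun u => (Real.exp_pos _).le)]
  exact ENNReal.ofReal_le_ofReal (convexOn_exp.map_integral_le Real.continuous_exp.continuousOn
    isClosed_univ (Filter.Eventually.of_forall fun u => mem_univ _) hint1 hint2)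

/-- Chernoff's bound for an average of random variables with uniformly bounded exponential
moments. -/
theorem measure_lt_integral_le_of_lintegral_exp_le {α Ω : Type*} [MeasurableSpace α]
    [MeasurableSpace Ω] {ν : Measure α} [IsProbabilityMeasure ν] {P : Measure Ω} [SFinite P]
    {Y : α → Ω → ℝ} (hY : Measurable fun q : α × Ω => Y q.1 q.2) {b : ℝ}
    (hb : ∀ᵐ u ∂ν, ∀ ω, |Y u ω| ≤ b) {l t : ℝ} (hl : 0 < l) {B : ℝ≥0∞}
    (hB : ∀ᵐ u ∂ν, ∫⁻ ω, ENNReal.ofReal (Real.exp (l * Y u ω)) ∂P ≤ B) :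
    P {ω | t < ∫ u, Y u ω ∂ν} ≤ ENNReal.ofReal (Real.exp (-(l * t))) * B := by
  have hEm : Measurable fun q : α × Ω => ENNReal.ofReal (Real.exp (l * Y q.1 q.2)) :=
    (Real.measurable_exp.comp (hY.const_mul l)).ennreal_ofReal
  have hJensen : ∀ ω, ENNReal.ofReal (Real.exp (l * ∫ u, Y u ω ∂ν))
      ≤ ∫⁻ u, ENNReal.ofReal (Real.exp (l * Y u ω)) ∂ν := by
    intro ω
    have hYω : Measurable fun u => Y u ω := hY.comp (measurable_id.prodMk measurable_const)
    rw [← integral_const_mul]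
    refine ofReal_exp_integral_le (hYω.const_mul l) (b := l * b) ?_
    filter_upwards [hb] with u hu
    rw [abs_mul, abs_of_pos hl]
    exact mul_le_mul_of_nonneg_left (hu ω) hl.le
  have hPhi : ∫⁻ ω, ∫⁻ u, ENNReal.ofReal (Real.exp (l * Y u ω)) ∂ν ∂P ≤ B := by
    rw [lintegral_lintegral_swap (f := fun ω u => ENNReal.ofReal (Real.exp (l * Y u ω)))
      (hEm.comp measurable_swap).aemeasurable]
    exact (lintegral_mono_ae hB).trans (by simp)
  have hmarkov := mul_meas_ge_le_lintegral₀ (μ := P)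
    (f := fun ω => ∫⁻ u, ENNReal.ofReal (Real.exp (l * Y u ω)) ∂ν)
    (hEm.lintegral_prod_left').aemeasurable (ENNReal.ofReal (Real.exp (l * t)))
  have hsub : {ω | t < ∫ u, Y u ω ∂ν} ⊆ {ω | ENNReal.ofReal (Real.exp (l * t))
      ≤ ∫⁻ u, ENNReal.ofReal (Real.exp (l * Y u ω)) ∂ν} := by
    intro ω hω
    refine le_trans (ENNReal.ofReal_le_ofReal (Real.exp_le_exp.2 ?_)) (hJensen ω)
    exact mul_le_mul_of_nonneg_left (le_of_lt hω) hl.le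
  calc P {ω | t < ∫ u, Y u ω ∂ν}
      = ENNReal.ofReal (Real.exp (-(l * t))) * (ENNReal.ofReal (Real.exp (l * t)) *
          P {ω | t < ∫ u, Y u ω ∂ν}) := by
        rw [← mul_assoc, ← ENNReal.ofReal_mul (Real.exp_pos _).le, ← Real.exp_add]
        simp
    _ ≤ _ := by
        gcongr
        refine le_trans ?_ (hmarkov.trans hPhi)
        gcongr

/-- Tail estimate for the truncated average of a local function. Jensen's inequality in the
position `u` of the shifted lattice `u + R ℤ^d` reduces the average to sums over such lattices. -/
theorem measure_lt_localAverage_le {d : ℕ} (hd : 0 < d) {Ω : Type*} [MeasurableSpace Ω]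
    {P : Measure Ω} [IsProbabilityMeasure P] {A : EuclideanSpace ℝ (Fin d) → Ω → ℝ}
    (hA : Measurable (fun p : EuclideanSpace ℝ (Fin d) × Ω => A p.1 p.2))
    (hs : IsStationary P A) {g : (EuclideanSpace ℝ (Fin d) → ℝ) → ℝ} {R L M a l t : ℝ}
    (hg : Measurable[sigmaRestrict (fun x (φ : EuclideanSpace ℝ (Fin d) → ℝ) => φ x)
      (Metric.ball 0 (R / 4))] g) (hg0 : Measurable g) (hgM : ∀ φ, |g φ| ≤ M)
    (hR : 0 < R) (hRL : R ≤ L) (hl : 0 < l) {n : ℕ}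
    (hα : alphaMixingCoeff P A (R / 2) (ENNReal.ofReal (d * (R * (2 * n)) + R)) ≤ a) {W : ℝ}
    (hW : W = Real.exp d * ∫ y : EuclideanSpace ℝ (Fin d), Real.exp (-‖y‖)) :
    P {ω | t < (L ^ d)⁻¹ * ∫ y in cell R ⁻¹'
          (Finset.Icc (fun _ : Fin d => -(n : ℤ)) (fun _ => (n : ℤ)) : Set (Fin d → ℤ)),
          Real.exp (-‖y‖ / L) *
            (g (fun x => A (x + y) ω) - ∫ ω', g (fun x => A x ω') ∂P)}
      ≤ ENNReal.ofReal (Real.exp (-(l * t))) *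
        (ENNReal.ofReal (Real.exp (l ^ 2 * M ^ 2 / 2 * ((R / L) ^ d * W)))
        + ((2 * n + 1) ^ d : ℕ) * ENNReal.ofReal a
          * ENNReal.ofReal (Real.exp (2 * M * l * W))) := by
  set s := Finset.Icc (fun _ : Fin d => -(n : ℤ)) (fun _ => (n : ℤ)) with hsdef
  set m := ∫ ω', g (fun x => A x ω') ∂P with hm
  have hL : 0 < L := hR.trans_le hRL
  have hAx : ∀ x, Measurable (A x) := measurable_apply_of_joint hA
  have hmM : |m| ≤ M := abs_integral_le_of_abs_le (Filter.Eventually.of_forall fun ω => hgM _)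
  have hM : 0 ≤ M := (abs_nonneg m).trans hmM
  have hGm : Measurable fun q : EuclideanSpace ℝ (Fin d) × Ω => g (fun x => A (x + q.1) q.2) :=
    hg0.comp (measurable_shift hA)
  -- the sum over the shifted lattice `u + R ℤ^d`
  let Y : EuclideanSpace ℝ (Fin d) → Ω → ℝ := fun u ω => ∑ z ∈ s,
    (R / L) ^ d * Real.exp (-‖u + latticePoint R z‖ / L) *
      (g (fun x => A (x + (u + latticePoint R z)) ω) - m)
  have hYm : Measurable fun q : EuclideanSpace ℝ (Fin d) × Ω => Y q.1 q.2 := by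
    refine Finset.measurable_fun_sum _ fun z _ => Measurable.mul ?_ (Measurable.sub_const ?_ m)
    · fun_prop
    · exact hGm.comp ((measurable_fst.add_const (latticePoint R z)).prodMk measurable_snd)
  have hYb : ∀ u ∈ cube d R, ∀ ω, |Y u ω| ≤ 2 * M * W := by
    intro u hu ω
    calc |Y u ω| ≤ ∑ z ∈ s, (R / L) ^ d * Real.exp (-‖u + latticePoint R z‖ / L) * (2 * M) := by
          refine (Finset.abs_sum_le_sum_abs _ _).trans (Finset.sum_le_sum fun z _ => ?_)
          rw [abs_mul, abs_of_nonneg (a := (R / L) ^ d * _) (by positivity)]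
          gcongr
          refine (abs_sub _ _).trans ?_
          linarith [hgM fun x => A (x + (u + latticePoint R z)) ω]
      _ ≤ 2 * M * W := by
          rw [← Finset.sum_mul, mul_comm (2 * M), hW]
          gcongr
          exact sum_exp_neg_norm_div_le hd hR hRL hu s
  set ν : Measure (EuclideanSpace ℝ (Fin d)) := volume[|cube d R] with hν
  have hvol0 : volume (cube d R) ≠ 0 := by
    rw [volume_cube hR]
    simpa using pow_pos hR d
  have hvoltop : volume (cube d R) ≠ ∞ := by simp [volume_cube hR]
  have : IsProbabilityMeasure ν := cond_isProbabilityMeasure_of_finite hvol0 hvoltop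
  have hνcube : ∀ᵐ u ∂ν, u ∈ cube d R := by
    rw [hν, ProbabilityTheory.cond]
    exact Measure.ae_smul_measure (ae_restrict_mem measurableSet_cube) _
  have hX : ∀ ω, (L ^ d)⁻¹ * ∫ y in cell R ⁻¹' (s : Set (Fin d → ℤ)),
      Real.exp (-‖y‖ / L) * (g (fun x => A (x + y) ω) - m) = ∫ u, Y u ω ∂ν := by
    intro ω
    have hmeas : Measurable fun y => g (fun x => A (x + y) ω) - m :=
      (hGm.comp (measurable_id.prodMk measurable_const)).sub_const m
    have hint : Integrable fun y => Real.exp (-‖y‖ / L) * (g (fun x => A (x + y) ω) - m) := by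
      refine (integrable_exp_neg_norm_div hd hL).mul_bdd (c := 2 * M)
        hmeas.aestronglyMeasurable (Filter.Eventually.of_forall fun y => ?_)
      refine (abs_sub _ _).trans ?_
      linarith [hgM fun x => A (x + y) ω]
    rw [setIntegral_cell_mem_eq hR hint s, hν, ProbabilityTheory.cond, integral_smul_measure,
      volume_cube hR, ENNReal.toReal_inv, ENNReal.toReal_ofReal (by positivity), smul_eq_mul,
      ← integral_const_mul, ← integral_const_mul]
    refine integral_congr_ae (Filter.Eventually.of_forall fun u => ?_)
    simp only [Y, Finset.mul_sum, div_pow]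
    refine Finset.sum_congr rfl fun z _ => ?_
    field_simp
  simp only [hX]
  have hu : ∀ u ∈ cube d R, ∫⁻ ω, ENNReal.ofReal (Real.exp (l * Y u ω)) ∂P
      ≤ ENNReal.ofReal (Real.exp (l ^ 2 * M ^ 2 / 2 * ((R / L) ^ d * W)))
        + ((2 * n + 1) ^ d : ℕ) * ENNReal.ofReal a
          * ENNReal.ofReal (Real.exp (2 * M * l * W)) := by
    intro u hu
    have h1 := lintegral_exp_sum_local_le hAx hs hg hg0 hgM hR
      (Δ := d * (R * (2 * n))) (by positivity) hl.le hα (fun z => u + latticePoint R z) s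
      (fun z _ z' _ h => by
        rw [dist_add_left, dist_eq_norm]
        exact le_norm_latticePoint_sub hR h)
      (fun z hz z' hz' => by
        rw [dist_add_left, dist_eq_norm]
        exact norm_latticePoint_sub_le hR hz hz')
      (w := fun z => (R / L) ^ d * Real.exp (-‖u + latticePoint R z‖ / L))
      (fun z => by positivity)
    rw [hsdef, card_Icc_neg_natCast, ← hsdef] at h1
    have hsum := sum_exp_neg_norm_div_le hd hR hRL hu s
    rw [← hW] at hsum
    refine h1.trans ?_
    gcongr
    calc ∑ z ∈ s, ((R / L) ^ d * Real.exp (-‖u + latticePoint R z‖ / L)) ^ 2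
        ≤ ∑ z ∈ s, (R / L) ^ d * ((R / L) ^ d * Real.exp (-‖u + latticePoint R z‖ / L)) := by
          refine Finset.sum_le_sum fun z _ => ?_
          rw [sq]
          gcongr
          refine mul_le_of_le_one_right (by positivity) (Real.exp_le_one_iff.2 ?_)
          rw [neg_div]
          exact neg_nonpos.2 (by positivity)
      _ ≤ (R / L) ^ d * W := by
          rw [← Finset.mul_sum]
          gcongr
  exact measure_lt_integral_le_of_lintegral_exp_le hYm
    (hνcube.mono fun u hu ω => hYb u hu ω) hl (hνcube.mono hu)

/-- Replacing `F` by a local approximation and truncating the average changes it by a small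
deterministic amount. -/
theorem spatialAverage_le_localAverage {d : ℕ} (hd : 0 < d) {Ω : Type*} [MeasurableSpace Ω]
    {P : Measure Ω} [IsProbabilityMeasure P] {A : EuclideanSpace ℝ (Fin d) → Ω → ℝ}
    (hA : Measurable (fun p : EuclideanSpace ℝ (Fin d) × Ω => A p.1 p.2))
    {f g : (EuclideanSpace ℝ (Fin d) → ℝ) → ℝ} (hf : Measurable f) (hg : Measurable g)
    {M ε R L : ℝ} (hgM : ∀ φ, |g φ| ≤ M)
    (hfg : ∀ y, ∀ᵐ ω ∂P, |f (fun x => A (x + y) ω)| ≤ M ∧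
        |f (fun x => A (x + y) ω) - g (fun x => A (x + y) ω)| ≤ ε)
    (hR : 0 < R) (hL : 0 < L) (n : ℕ) {c : ℝ}
    (hc : c = ∫ y : EuclideanSpace ℝ (Fin d), Real.exp (-‖y‖)) :
    ∀ᵐ ω ∂P, spatialAverage P A f L ω ≤ (L ^ d)⁻¹ * (∫ y in cell R ⁻¹'
          (Finset.Icc (fun _ : Fin d => -(n : ℤ)) (fun _ => (n : ℤ)) : Set (Fin d → ℤ)),
          Real.exp (-‖y‖ / L) *
            (g (fun x => A (x + y) ω) - ∫ ω', g (fun x => A x ω') ∂P))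
        + 2 * ε * c + 2 * M * (2 ^ d * c) * Real.exp (-(n * R) / (2 * L)) := by
  set U : Set (EuclideanSpace ℝ (Fin d)) := cell R ⁻¹'
    (Finset.Icc (fun _ : Fin d => -(n : ℤ)) (fun _ => (n : ℤ)) : Set (Fin d → ℤ)) with hU
  set m := ∫ ω', g (fun x => A x ω') ∂P with hm
  have hAx : ∀ x, Measurable (A x) := measurable_apply_of_joint hA
  have hFm : Measurable fun q : EuclideanSpace ℝ (Fin d) × Ω => f (fun x => A (x + q.1) q.2) :=
    hf.comp (measurable_shift hA)
  have hGm : Measurable fun q : EuclideanSpace ℝ (Fin d) × Ω => g (fun x => A (x + q.1) q.2) :=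
    hg.comp (measurable_shift hA)
  have hmM : |m| ≤ M := abs_integral_le_of_abs_le (Filter.Eventually.of_forall fun ω => hgM _)
  have hM : 0 ≤ M := (abs_nonneg m).trans hmM
  have hEF : |∫ ω', shiftField A f 0 ω' ∂P - m| ≤ ε := by
    have h0 := hfg 0
    simp only [add_zero] at h0
    simp only [shiftField, add_zero]
    have hA0 : Measurable fun (ω : Ω) (x : EuclideanSpace ℝ (Fin d)) => A x ω :=
      measurable_pi_lambda _ hAx
    rw [hm, ← integral_sub]
    · exact abs_integral_le_of_abs_le (h0.mono fun ω h => h.2)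
    · exact Integrable.of_bound (hf.comp hA0).aestronglyMeasurable M (h0.mono fun ω h => h.1)
    · exact Integrable.of_bound (hg.comp hA0).aestronglyMeasurable M
        (Filter.Eventually.of_forall fun ω => hgM _)
  have hae : ∀ᵐ ω ∂P, ∀ᵐ y : EuclideanSpace ℝ (Fin d), |f (fun x => A (x + y) ω)| ≤ M ∧
      |f (fun x => A (x + y) ω) - g (fun x => A (x + y) ω)| ≤ ε := by
    have hset : MeasurableSet {q : EuclideanSpace ℝ (Fin d) × Ω |
        |f (fun x => A (x + q.1) q.2)| ≤ M ∧
        |f (fun x => A (x + q.1) q.2) - g (fun x => A (x + q.1) q.2)| ≤ ε} :=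
      (measurableSet_le hFm.abs measurable_const).inter
        (measurableSet_le (hFm.sub hGm).abs measurable_const)
    exact (Measure.ae_ae_comm hset).1 (Filter.Eventually.of_forall hfg)
  filter_upwards [hae] with ω hω
  have he := integrable_exp_neg_norm_div (d := d) hd hL
  have hFω : Measurable fun y => f (fun x => A (x + y) ω) :=
    hFm.comp (measurable_id.prodMk measurable_const)
  have hGω : Measurable fun y => g (fun x => A (x + y) ω) :=
    hGm.comp (measurable_id.prodMk measurable_const)
  have hGb : ∀ y, |g (fun x => A (x + y) ω) - m| ≤ 2 * M := fun y =>
    (abs_sub _ _).trans (by linarith [hgM fun x => A (x + y) ω])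
  have hintF : Integrable fun y => Real.exp (-‖y‖ / L) *
      (shiftField A f y ω - ∫ ω', shiftField A f 0 ω' ∂P) := by
    refine he.mul_bdd (c := M + |∫ ω', shiftField A f 0 ω' ∂P|)
      (hFω.sub_const _).aestronglyMeasurable ?_
    filter_upwards [hω] with y hy
    refine (abs_sub _ _).trans ?_
    gcongr
    exact hy.1
  have hintG : Integrable fun y => Real.exp (-‖y‖ / L) * (g (fun x => A (x + y) ω) - m) :=
    he.mul_bdd (c := 2 * M) (hGω.sub_const _).aestronglyMeasurable
      (Filter.Eventually.of_forall hGb)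
  have h1 : ∫ y, Real.exp (-‖y‖ / L) * (shiftField A f y ω - ∫ ω', shiftField A f 0 ω' ∂P)
      ≤ (∫ y, Real.exp (-‖y‖ / L) * (g (fun x => A (x + y) ω) - m))
        + 2 * ε * (L ^ d * c) := by
    rw [hc, ← integral_exp_neg_norm_div hL, ← integral_const_mul,
      ← integral_add hintG (he.const_mul _)]
    refine integral_mono_ae hintF (hintG.add (he.const_mul _)) ?_
    filter_upwards [hω] with y hy
    have h2 := (abs_le.1 hy.2).2
    have h3 := (abs_le.1 hEF).1
    have h4 : shiftField A f y ω - ∫ ω', shiftField A f 0 ω' ∂P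
        ≤ g (fun x => A (x + y) ω) - m + 2 * ε := by
      have : shiftField A f y ω = f (fun x => A (x + y) ω) := rfl
      linarith
    calc _ ≤ Real.exp (-‖y‖ / L) * (g (fun x => A (x + y) ω) - m + 2 * ε) := by gcongr
      _ = _ := by ring
  have hUm : MeasurableSet U := measurable_cell (Finset.measurableSet _)
  have h2 : ∫ y in Uᶜ, Real.exp (-‖y‖ / L) * (g (fun x => A (x + y) ω) - m)
      ≤ 2 * M * Real.exp (-(n * R) / (2 * L)) * ((2 * L) ^ d * c) := by
    have he2 := integrable_exp_neg_norm_div (d := d) hd (L := 2 * L) (by positivity)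
    calc ∫ y in Uᶜ, Real.exp (-‖y‖ / L) * (g (fun x => A (x + y) ω) - m)
        ≤ ∫ y in Uᶜ, 2 * M * Real.exp (-(n * R) / (2 * L)) * Real.exp (-‖y‖ / (2 * L)) := by
          refine setIntegral_mono_on hintG.integrableOn (he2.const_mul _).integrableOn hUm.compl
            fun y hy => ?_
          have hy' : n * R ≤ ‖y‖ := le_norm_of_cell_notMem hR hy
          have h5 : Real.exp (-‖y‖ / L)
              ≤ Real.exp (-(n * R) / (2 * L)) * Real.exp (-‖y‖ / (2 * L)) := by
            rw [← Real.exp_add, Real.exp_le_exp]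
            have : -‖y‖ / L = -‖y‖ / (2 * L) + -‖y‖ / (2 * L) := by field_simp; ring
            rw [this]
            gcongr
          calc _ ≤ Real.exp (-‖y‖ / L) * (2 * M) := by
                gcongr
                exact (abs_le.1 (hGb y)).2
            _ ≤ Real.exp (-(n * R) / (2 * L)) * Real.exp (-‖y‖ / (2 * L)) * (2 * M) := by gcongr
            _ = _ := by ring
      _ ≤ ∫ y : EuclideanSpace ℝ (Fin d),
            2 * M * Real.exp (-(n * R) / (2 * L)) * Real.exp (-‖y‖ / (2 * L)) :=
          setIntegral_le_integral (he2.const_mul _)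
            (Filter.Eventually.of_forall fun y => by positivity)
      _ = _ := by rw [integral_const_mul, integral_exp_neg_norm_div (by positivity), hc]
  rw [← integral_add_compl hUm hintG] at h1
  have hLd : 0 < L ^ d := pow_pos hL d
  calc spatialAverage P A f L ω
      ≤ (L ^ d)⁻¹ * ((∫ y in U, Real.exp (-‖y‖ / L) * (g (fun x => A (x + y) ω) - m))
        + 2 * M * Real.exp (-(n * R) / (2 * L)) * ((2 * L) ^ d * c) + 2 * ε * (L ^ d * c)) := by
        rw [spatialAverage]
        gcongr
        linarith
    _ = _ := by
        rw [mul_pow]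
        field_simp
        ring

/-! ### Choice of the scales and conclusion -/

theorem spatialAverage_le {d : ℕ} (hd : 0 < d) {Ω : Type*} [MeasurableSpace Ω]
    {P : Measure Ω} [IsProbabilityMeasure P] {A : EuclideanSpace ℝ (Fin d) → Ω → ℝ}
    (hA : Measurable (fun p : EuclideanSpace ℝ (Fin d) × Ω => A p.1 p.2))
    {f : (EuclideanSpace ℝ (Fin d) → ℝ) → ℝ} (hf : Measurable f) {M L : ℝ}
    (hfM : ∀ y, ∀ᵐ ω ∂P, |f (fun x => A (x + y) ω)| ≤ M) (hL : 0 < L) :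
    ∀ᵐ ω ∂P, spatialAverage P A f L ω
      ≤ 2 * M * ∫ y : EuclideanSpace ℝ (Fin d), Real.exp (-‖y‖) := by
  have hFm : Measurable fun q : EuclideanSpace ℝ (Fin d) × Ω => f (fun x => A (x + q.1) q.2) :=
    hf.comp (measurable_shift hA)
  have hEF : |∫ ω', shiftField A f 0 ω' ∂P| ≤ M := abs_integral_le_of_abs_le (hfM 0)
  have hae : ∀ᵐ ω ∂P, ∀ᵐ y : EuclideanSpace ℝ (Fin d), |f (fun x => A (x + y) ω)| ≤ M :=
    (Measure.ae_ae_comm (p := fun y ω => |f (fun x => A (x + y) ω)| ≤ M)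
      (measurableSet_le hFm.abs measurable_const)).1 (Filter.Eventually.of_forall hfM)
  filter_upwards [hae] with ω hω
  have he := (integrable_exp_neg_norm_div (d := d) hd hL).const_mul (2 * M)
  have h1 : ‖∫ y, Real.exp (-‖y‖ / L) * (shiftField A f y ω - ∫ ω', shiftField A f 0 ω' ∂P)‖
      ≤ ∫ y : EuclideanSpace ℝ (Fin d), 2 * M * Real.exp (-‖y‖ / L) := by
    refine norm_integral_le_of_norm_le he ?_
    filter_upwards [hω] with y hy
    rw [Real.norm_eq_abs, abs_mul, Real.abs_exp, mul_comm]
    gcongr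
    refine (abs_sub _ _).trans ?_
    have : |shiftField A f y ω| ≤ M := hy
    linarith
  rw [integral_const_mul, integral_exp_neg_norm_div hL] at h1
  have hLd : 0 < L ^ d := pow_pos hL d
  calc spatialAverage P A f L ω ≤ (L ^ d)⁻¹ * (2 * M *
        (L ^ d * ∫ y : EuclideanSpace ℝ (Fin d), Real.exp (-‖y‖))) := by
        rw [spatialAverage]
        gcongr
        exact (le_abs_self _).trans h1
    _ = _ := by field_simp

theorem rpow_mul_exp_neg_le {x s : ℝ} (hx : 0 ≤ x) (hs : 0 < s) :
    x ^ s * Real.exp (-x) ≤ s ^ s := by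
  have h1 : x / s ≤ Real.exp (x / s) := by linarith [Real.add_one_le_exp (x / s)]
  have h2 : (x / s) ^ s ≤ Real.exp x := by
    refine (Real.rpow_le_rpow (by positivity) h1 hs.le).trans_eq ?_
    rw [← Real.exp_mul, div_mul_cancel₀ _ hs.ne']
  rw [Real.div_rpow hx hs.le, div_le_iff₀ (by positivity)] at h2
  rw [Real.exp_neg, ← div_eq_mul_inv, div_le_iff₀ (Real.exp_pos _)]
  linarith

/-- The number of cubes and the mixing prefactor are absorbed by the stretched exponential. -/
theorem exists_prefactor_le (d : ℕ) {K γ : ℝ} (hK : 0 < K) (hγ : 0 < γ) :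
    ∃ Q : ℝ, 0 < Q ∧ ∀ L R : ℝ, 1 ≤ L → 0 < R → R ≤ L →
      ((2 * ⌈L ^ 2⌉₊ + 1) ^ d : ℕ) * (K * (1 + (d * (R * (2 * ⌈L ^ 2⌉₊)) + R)) ^ K)
        * Real.exp (-(L ^ γ)) ≤ Q := by
  have hq : 0 < 2 * d + 3 * K := by positivity
  refine ⟨5 ^ d * (K * (4 * d + 2) ^ K) * ((2 * d + 3 * K) / γ) ^ ((2 * d + 3 * K) / γ),
    by positivity, fun L R hL hR hRL => ?_⟩
  have hL0 : 0 < L := by linarith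
  have hL2 : 1 ≤ L ^ 2 := one_le_pow₀ hL
  have hn : (⌈L ^ 2⌉₊ : ℝ) ≤ 2 * L ^ 2 := by
    linarith [Nat.ceil_lt_add_one (zero_le_one.trans hL2)]
  have h1 : (((2 * ⌈L ^ 2⌉₊ + 1) ^ d : ℕ) : ℝ) ≤ 5 ^ d * L ^ (2 * d : ℝ) := by
    have : L ^ (2 * d : ℝ) = (L ^ 2) ^ d := by
      rw [← pow_mul, ← Real.rpow_natCast]
      norm_num
    rw [this, ← mul_pow]
    push_cast
    gcongr
    linarith
  have h2 : (1 + (d * (R * (2 * ⌈L ^ 2⌉₊)) + R)) ^ K ≤ (4 * d + 2) ^ K * L ^ (3 * K) := by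
    have : L ^ (3 * K) = (L ^ 3) ^ K := by
      rw [← Real.rpow_natCast, ← Real.rpow_mul hL0.le]
      norm_num
    rw [this, ← Real.mul_rpow (by positivity) (by positivity)]
    refine Real.rpow_le_rpow (by positivity) ?_ hK.le
    have h3 : L ≤ L ^ 3 := le_self_pow₀ hL (by norm_num)
    calc 1 + (d * (R * (2 * ⌈L ^ 2⌉₊)) + R) ≤ L + (d * (L * (2 * (2 * L ^ 2))) + L) := by gcongr
      _ = 4 * d * L ^ 3 + 2 * L := by ring
      _ ≤ 4 * d * L ^ 3 + 2 * L ^ 3 := by gcongr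
      _ = _ := by ring
  have h4 : L ^ (2 * d : ℝ) * L ^ (3 * K) * Real.exp (-(L ^ γ))
      ≤ ((2 * d + 3 * K) / γ) ^ ((2 * d + 3 * K) / γ) := by
    have := rpow_mul_exp_neg_le (Real.rpow_nonneg hL0.le γ) (div_pos hq hγ)
    rwa [← Real.rpow_mul hL0.le, mul_div_cancel₀ _ hγ.ne', Real.rpow_add hL0] at this
  calc _ ≤ 5 ^ d * L ^ (2 * d : ℝ) * (K * ((4 * d + 2) ^ K * L ^ (3 * K)))
        * Real.exp (-(L ^ γ)) := by gcongr
    _ = 5 ^ d * (K * (4 * d + 2) ^ K) *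
        (L ^ (2 * d : ℝ) * L ^ (3 * K) * Real.exp (-(L ^ γ))) := by ring
    _ ≤ _ := by gcongr

/-- The mesh `R = C₁ ℓ^(β/(d+β)) L^(d/(d+β))`: the fluctuation exponent `(L/R)^d` is then comparable
to `(L/ℓ)^(dβ/(d+β))`, while the mixing exponent `R^β` dominates `L^(dβ/(d+β))` with a large
constant, and `R` is large compared to `ℓ`. -/
theorem exists_scale {d : ℕ} {β K κ H q : ℝ} (hβ : 0 < β) (hK : 0 < K) (hκ : 0 < κ)
    (hH : 0 ≤ H) (hq : 0 ≤ q) :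
    ∃ C₁ B : ℝ, 1 ≤ C₁ ∧ 1 ≤ B ∧ ∀ ℓ L : ℝ, 1 ≤ ℓ → B * ℓ ≤ L → ∃ R : ℝ, 1 ≤ R ∧ R ≤ L ∧
      (L / R) ^ d = (L / ℓ) ^ (d * β / (d + β)) / C₁ ^ d ∧ ℓ + H ≤ R / (4 * κ) ∧
      2 * (ℓ + H) ≤ L ∧ q * L ^ (d * β / (d + β)) ≤ (R / 2) ^ β / K := by
  set θ := β / (d + β) with hθ
  have hdβ : 0 < d + β := by positivity
  have hθ0 : 0 < θ := by positivity
  have hγ : d * β / (d + β) = θ * d := by rw [hθ]; ring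
  have hγ' : d * β / (d + β) = (1 - θ) * β := by rw [hθ]; field_simp; ring
  have hθ1 : 0 ≤ 1 - θ := by
    have : 1 - θ = d / (d + β) := by rw [hθ]; field_simp; ring
    rw [this]
    positivity
  set C₁ := 1 + 4 * κ * (1 + H) + 2 * (K * q) ^ (1 / β) with hC₁
  have hKq : 0 ≤ 2 * (K * q) ^ (1 / β) := by positivity
  have hκH : 0 ≤ 4 * κ * (1 + H) := by positivity
  have hC1 : 1 ≤ C₁ := by linarith
  have hC0 : 0 < C₁ := by linarith
  have hB1 : 1 ≤ C₁ ^ (1 / θ) := Real.one_le_rpow hC1 (by positivity)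
  refine ⟨C₁, C₁ ^ (1 / θ) + 2 * (1 + H), hC1, by linarith, fun ℓ L hℓ hBL => ?_⟩
  have hℓ0 : 0 < ℓ := by linarith
  have hB : C₁ ^ (1 / θ) * ℓ ≤ L := le_trans (by gcongr; linarith) hBL
  have hHL : 2 * (1 + H) * ℓ ≤ L := le_trans (by gcongr; linarith) hBL
  have hℓL : ℓ ≤ L := le_trans (by nlinarith) hB
  have hL0 : 0 < L := by linarith
  have hLL : L ^ θ * L ^ (1 - θ) = L := by
    rw [← Real.rpow_add hL0]
    simp
  have hR1 : C₁ * ℓ ≤ C₁ * ℓ ^ θ * L ^ (1 - θ) := by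
    have : ℓ ^ θ * ℓ ^ (1 - θ) = ℓ := by
      rw [← Real.rpow_add hℓ0]
      simp
    calc C₁ * ℓ = C₁ * ℓ ^ θ * ℓ ^ (1 - θ) := by rw [mul_assoc, this]
      _ ≤ _ := by gcongr
  have hℓH : ℓ + H ≤ (1 + H) * ℓ := by nlinarith
  have hR0 : 0 < C₁ * ℓ ^ θ * L ^ (1 - θ) := by positivity
  refine ⟨C₁ * ℓ ^ θ * L ^ (1 - θ), le_trans (by nlinarith) hR1, ?_, ?_, ?_, by nlinarith, ?_⟩
  · have h1 : C₁ * ℓ ^ θ ≤ L ^ θ := by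
      refine le_trans (le_of_eq ?_) (Real.rpow_le_rpow (by positivity) hB hθ0.le)
      rw [Real.mul_rpow (by positivity) hℓ0.le, ← Real.rpow_mul hC0.le, one_div,
        inv_mul_cancel₀ hθ0.ne', Real.rpow_one]
    calc _ ≤ L ^ θ * L ^ (1 - θ) := by gcongr
      _ = L := hLL
  · have h1 : L / (C₁ * ℓ ^ θ * L ^ (1 - θ)) = (L / ℓ) ^ θ / C₁ := by
      rw [Real.div_rpow hL0.le hℓ0.le]
      conv_lhs => rw [← hLL]
      have := (Real.rpow_pos_of_pos hL0 (1 - θ)).ne'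
      have := (Real.rpow_pos_of_pos hL0 θ).ne'
      have := (Real.rpow_pos_of_pos hℓ0 θ).ne'
      rw [hLL]
      field_simp
      rw [mul_comm, hLL]
    rw [h1, div_pow, hγ, Real.rpow_mul (by positivity), Real.rpow_natCast]
  · rw [le_div_iff₀ (by positivity)]
    calc (ℓ + H) * (4 * κ) ≤ (1 + H) * ℓ * (4 * κ) := by gcongr
      _ = 4 * κ * (1 + H) * ℓ := by ring
      _ ≤ C₁ * ℓ := by gcongr; linarith
      _ ≤ _ := hR1
  · have h1 : 2 * (K * q) ^ (1 / β) * L ^ (1 - θ) ≤ C₁ * ℓ ^ θ * L ^ (1 - θ) := by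
      refine mul_le_mul_of_nonneg_right ?_ (by positivity)
      calc 2 * (K * q) ^ (1 / β) ≤ C₁ * 1 := by linarith
        _ ≤ C₁ * ℓ ^ θ := by
          gcongr
          exact Real.one_le_rpow hℓ hθ0.le
    have h2 : ((K * q) ^ (1 / β) * L ^ (1 - θ)) ^ β = K * q * L ^ ((1 - θ) * β) := by
      rw [Real.mul_rpow (by positivity) (by positivity), ← Real.rpow_mul (by positivity),
        ← Real.rpow_mul hL0.le, one_div, inv_mul_cancel₀ hβ.ne', Real.rpow_one]
    rw [le_div_iff₀ hK, hγ']
    calc q * L ^ ((1 - θ) * β) * K = ((K * q) ^ (1 / β) * L ^ (1 - θ)) ^ β := by rw [h2]; ring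
      _ ≤ _ := Real.rpow_le_rpow (by positivity) (by linarith) hβ.le

/-- Chernoff's bound for `X_L` at a given mesh `R`, provided that the approximation errors are at
most `δ / 2`. -/
theorem measureReal_lt_spatialAverage_le {d : ℕ} (hd : 0 < d) {Ω : Type*} [MeasurableSpace Ω]
    {P : Measure Ω} [IsProbabilityMeasure P] {A : EuclideanSpace ℝ (Fin d) → Ω → ℝ}
    (hA : Measurable (fun p : EuclideanSpace ℝ (Fin d) × Ω => A p.1 p.2))
    (hs : IsStationary P A) {f : (EuclideanSpace ℝ (Fin d) → ℝ) → ℝ} (hf : Measurable f)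
    {M R L ε a l δ : ℝ} (hM : 0 ≤ M) (hfM : ∀ᵐ ω ∂P, |f (fun x => A x ω)| ≤ M)
    (hloc : ∀ᵐ ω ∂P, |f (fun x => A x ω)
      - (P[fun ω' => f (fun x => A x ω') | sigmaRestrict A (Metric.ball 0 (R / 4))]) ω| ≤ ε)
    (hR : 0 < R) (hRL : R ≤ L) (hl : 0 < l) {n : ℕ} (ha : 0 ≤ a)
    (hα : alphaMixingCoeff P A (R / 2) (ENNReal.ofReal (d * (R * (2 * n)) + R)) ≤ a) {c : ℝ}
    (hc : c = ∫ y : EuclideanSpace ℝ (Fin d), Real.exp (-‖y‖))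
    (herr : 2 * ε * c + 2 * M * (2 ^ d * c) * Real.exp (-(n * R) / (2 * L)) ≤ δ / 2) :
    P.real {ω | δ < spatialAverage P A f L ω} ≤ Real.exp (-(l * (δ / 2))) *
      (Real.exp (l ^ 2 * M ^ 2 / 2 * ((R / L) ^ d * (Real.exp d * c)))
        + ((2 * n + 1) ^ d : ℕ) * a * Real.exp (2 * M * l * (Real.exp d * c))) := by
  have hL : 0 < L := hR.trans_le hRL
  obtain ⟨g, hg, hg0, hgM, hfg⟩ := exists_local_approx (measurable_apply_of_joint hA) hs hf hM hfM
    hloc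
  have hpath := spatialAverage_le_localAverage hd hA hf hg0 hgM hfg hR hL n hc
  have htail := measure_lt_localAverage_le (t := δ / 2) hd hA hs hg hg0 hgM hR hRL hl hα
    (W := Real.exp d * c) (by rw [hc])
  rw [measureReal_def]
  refine ENNReal.toReal_le_of_le_ofReal (by positivity)
    (le_trans (measure_mono_ae ?_) (htail.trans_eq ?_))
  · filter_upwards [hpath] with ω hω hω'
    refine lt_of_not_ge fun h => ?_
    have h1 : δ < spatialAverage P A f L ω := hω'
    linarith
  · rw [ENNReal.ofReal_mul (Real.exp_pos _).le, ENNReal.ofReal_add (by positivity)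
      (by positivity), ENNReal.ofReal_mul (by positivity), ENNReal.ofReal_mul (by positivity),
      ENNReal.ofReal_natCast]

/-- Optimization of Chernoff's bound: `l = a δ Γ` with `a = 1 / (2 M² W)` makes the quadratic term
half as large as the linear one. -/
theorem chernoff_optimize {M W δ Γ p Q a : ℝ} (hM : 1 ≤ M) (hW : 0 < W) (hδ : 0 < δ) (hΓ : 0 < Γ)
    (hp : 0 ≤ p) (ha : a = 1 / (2 * M ^ 2 * W)) (hQ : p * Real.exp (δ * Γ) ≤ Q) :
    Real.exp (-(a * δ * Γ * (δ / 2))) * (Real.exp ((a * δ * Γ) ^ 2 * M ^ 2 / 2 * (Γ⁻¹ * W))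
        + p * Real.exp (2 * M * (a * δ * Γ) * W))
      ≤ (1 + Q) * Real.exp (-(a * δ ^ 2 * Γ / 4)) := by
  have hM0 : 0 < M := by linarith
  have ha0 : 0 < a := by rw [ha]; positivity
  have he1 : (a * δ * Γ) ^ 2 * M ^ 2 / 2 * (Γ⁻¹ * W) = a * δ ^ 2 * Γ / 4 := by
    rw [ha]
    field_simp
    norm_num
  have he2 : 2 * M * (a * δ * Γ) * W ≤ δ * Γ := by
    have h1 : 2 * M * (a * δ * Γ) * W = δ * Γ / M := by
      rw [ha]
      field_simp
    rw [h1]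
    exact div_le_self (by positivity) hM
  have hQ0 : 0 ≤ Q := le_trans (by positivity) hQ
  have he3 : p * Real.exp (2 * M * (a * δ * Γ) * W) ≤ Q * Real.exp (a * δ ^ 2 * Γ / 4) :=
    calc p * Real.exp (2 * M * (a * δ * Γ) * W) ≤ p * Real.exp (δ * Γ) := by gcongr
      _ ≤ Q := hQ
      _ ≤ _ := le_mul_of_one_le_right hQ0 (Real.one_le_exp (by positivity))
  rw [he1]
  calc _ ≤ Real.exp (-(a * δ * Γ * (δ / 2))) * (Real.exp (a * δ ^ 2 * Γ / 4)
        + Q * Real.exp (a * δ ^ 2 * Γ / 4)) := by gcongr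
    _ = (1 + Q) * (Real.exp (-(a * δ * Γ * (δ / 2))) * Real.exp (a * δ ^ 2 * Γ / 4)) := by ring
    _ = _ := by
        rw [← Real.exp_add]
        congr 2
        ring

theorem mul_exp_neg_le_mul_exp_neg {a b q C T : ℝ} (ha : 0 < a) (hb : 0 < b) (hT : 0 ≤ T)
    (hq : q ≤ C) (hC : 4 * b / a ≤ C) :
    q * Real.exp (-(a * (T / b) / 4)) ≤ C * Real.exp (-(1 / C) * T) := by
  have hba : 0 < 4 * b / a := by positivity
  have hC0 : 0 < C := hba.trans_le hC
  have h1 : 1 / C ≤ a / (4 * b) := by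
    rw [← one_div_div (4 * b) a]
    exact one_div_le_one_div_of_le hba hC
  have h2 : 1 / C * T ≤ a * (T / b) / 4 :=
    calc 1 / C * T ≤ a / (4 * b) * T := by gcongr
      _ = _ := by field_simp
  have h3 : -(a * (T / b) / 4) ≤ -(1 / C) * T := by linarith
  gcongr

theorem one_le_mul_exp_neg {C T : ℝ} (hC : 3 ≤ C) (hT : T ≤ C) :
    1 ≤ C * Real.exp (-(1 / C) * T) := by
  have hC0 : 0 < C := by linarith
  have h2 : -1 ≤ -(1 / C) * T := by
    rw [neg_mul, neg_le_neg_iff, one_div, inv_mul_le_iff₀ hC0]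
    linarith
  have h4 : 1 ≤ C * Real.exp (-1) := by
    rw [Real.exp_neg, ← div_eq_mul_inv, one_le_div (Real.exp_pos _)]
    linarith [Real.exp_one_lt_three]
  exact h4.trans (by gcongr)

/-- The errors made by localizing at scale `R / 4` and truncating at distance `n R ≥ L²` are
controlled by `exp(-|log δ|) ≤ δ`. -/
theorem approximation_error_le {κ c b δ R L n H : ℝ} (hκ : 0 < κ) (hc : 0 ≤ c) (hb : 0 ≤ b)
    (hδ : 0 < δ) (hR : 1 ≤ R) (hL : 1 ≤ L) (hn : L ^ 2 ≤ n) (hH : H = 8 * κ * c + 8 * b)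
    (hRκ : |Real.log δ| + 1 + H ≤ R / (4 * κ)) (hLH : 2 * (|Real.log δ| + 1 + H) ≤ L) :
    2 * (κ * Real.exp (-(R / 4) / κ)) * c + 2 * b * Real.exp (-(n * R) / (2 * L)) ≤ δ / 2 := by
  set ℓ := |Real.log δ| + 1 with hℓ
  have hL0 : 0 < L := by linarith
  have hsmall : H * Real.exp (-(ℓ + H)) ≤ δ := by
    have h1 : H ≤ Real.exp H := by linarith [Real.add_one_le_exp H]
    have h2 : Real.exp (-ℓ) ≤ δ := by
      conv_rhs => rw [← Real.exp_log hδ]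
      refine Real.exp_le_exp.2 ?_
      linarith [neg_abs_le (Real.log δ)]
    calc H * Real.exp (-(ℓ + H)) ≤ Real.exp H * Real.exp (-(ℓ + H)) := by gcongr
      _ = Real.exp (-ℓ) := by rw [← Real.exp_add]; congr 1; ring
      _ ≤ δ := h2
  have h1 : Real.exp (-(R / 4) / κ) ≤ Real.exp (-(ℓ + H)) := by
    refine Real.exp_le_exp.2 ?_
    have : -(R / 4) / κ = -(R / (4 * κ)) := by field_simp
    linarith
  have h2 : Real.exp (-(n * R) / (2 * L)) ≤ Real.exp (-(ℓ + H)) := by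
    refine Real.exp_le_exp.2 ?_
    rw [neg_div, neg_le_neg_iff, le_div_iff₀ (by positivity)]
    have h3 : L ^ 2 ≤ n * R := hn.trans (le_mul_of_one_le_right ((sq_nonneg L).trans hn) hR)
    nlinarith
  calc _ ≤ 2 * (κ * Real.exp (-(ℓ + H))) * c + 2 * b * Real.exp (-(ℓ + H)) := by gcongr
    _ = (H * Real.exp (-(ℓ + H))) / 4 := by rw [hH]; ring
    _ ≤ δ / 2 := by linarith

/-- The tail estimate under `α`-mixing. -/
theorem exists_tail_bound_of_mixing {d : ℕ} (hd : 0 < d) {β K κ M : ℝ} (hβ : 0 < β)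
    (hK : 0 < K) (hκ : 0 < κ) (hM : 1 ≤ M) :
    ∃ C : ℝ, 0 < C ∧ ∀ (Ω : Type*) [MeasurableSpace Ω] (P : Measure Ω) [IsProbabilityMeasure P]
      (A : EuclideanSpace ℝ (Fin d) → Ω → ℝ) (f : (EuclideanSpace ℝ (Fin d) → ℝ) → ℝ),
      Measurable (fun p : EuclideanSpace ℝ (Fin d) × Ω => A p.1 p.2) → IsStationary P A →
      (∀ l D : ℝ, 0 ≤ l → 0 ≤ D → alphaMixingCoeff P A l (ENNReal.ofReal D)
        ≤ K * (1 + D) ^ K * Real.exp (-(l ^ β) / K)) →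
      Measurable f → (∀ᵐ ω ∂P, |f (fun x => A x ω)| ≤ M) →
      (∀ l : ℝ, 0 ≤ l → ∀ᵐ ω ∂P, |f (fun x => A x ω)
        - (P[fun ω' => f (fun x => A x ω') | sigmaRestrict A (Metric.ball 0 l)]) ω|
          ≤ κ * Real.exp (-l / κ)) →
      ∀ δ L : ℝ, 0 < δ → 1 ≤ L → P.real {ω | δ < spatialAverage P A f L ω} ≤
        C * Real.exp (-(1 / C) *
          (δ ^ 2 * (|Real.log δ| + 1) ^ (-(d * β / (d + β))) * L ^ (d * β / (d + β)))) := by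
  set γ := d * β / (d + β) with hγ
  have hd' : (0 : ℝ) < d := by exact_mod_cast hd
  have hγ0 : 0 < γ := by positivity
  have hM0 : 0 < M := by linarith
  set c := ∫ y : EuclideanSpace ℝ (Fin d), Real.exp (-‖y‖) with hc
  have hc0 : 0 < c := integral_exp_pos (integrable_exp_neg_norm hd)
  set W := Real.exp d * c with hW
  have hW0 : 0 < W := by positivity
  set δ₀ := 2 * M * c with hδ₀
  have hδ₀0 : 0 < δ₀ := by positivity
  set H := 8 * κ * c + 8 * M * (2 ^ d * c) with hH
  have hH0 : 0 < H := by positivity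
  set a := 1 / (2 * M ^ 2 * W) with ha
  have ha0 : 0 < a := by positivity
  obtain ⟨C₁, B, hC₁, hB, hscale⟩ := exists_scale (d := d) (κ := κ) (H := H) (q := δ₀ + 1)
    hβ hK hκ hH0.le (by positivity)
  obtain ⟨Q, hQ, hpref⟩ := exists_prefactor_le d hK hγ0
  have hC₁0 : 0 < C₁ := by linarith
  have hB0 : 0 < B := by linarith
  set C := (1 + Q) + 4 * C₁ ^ d / a + δ₀ ^ 2 * B ^ γ + 3 with hC
  have hCa : 0 < 4 * C₁ ^ d / a := by positivity
  have hCB : 0 < δ₀ ^ 2 * B ^ γ := by positivity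
  have hC0 : 0 < C := by positivity
  refine ⟨C, hC0, ?_⟩
  intro Ω _ P _ A f hA hs hα hf hfM hloc δ L hδ hL
  have hL0 : 0 < L := by linarith
  have hAx : ∀ x, Measurable (A x) := measurable_apply_of_joint hA
  set ℓ := |Real.log δ| + 1 with hℓ
  have hℓ1 : 1 ≤ ℓ := by linarith [abs_nonneg (Real.log δ)]
  have hℓ0 : 0 < ℓ := by linarith
  have hT : δ ^ 2 * ℓ ^ (-γ) * L ^ γ = δ ^ 2 * (L / ℓ) ^ γ := by
    rw [Real.div_rpow hL0.le hℓ0.le, Real.rpow_neg hℓ0.le]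
    field_simp
  rw [hT]
  -- `|X_L| ≤ δ₀` almost surely, so only `δ ≤ δ₀` matters
  rcases lt_or_ge δ₀ δ with hδδ | hδδ
  · obtain ⟨g, -, -, -, hfg⟩ := exists_local_approx hAx hs hf hM0.le hfM (hloc 0 le_rfl)
    have h0 : P.real {ω | δ < spatialAverage P A f L ω} = 0 := by
      rw [measureReal_eq_zero_iff]
      refine measure_mono_null (fun ω hω => ?_)
        (ae_iff.1 (spatialAverage_le hd hA hf (fun y => (hfg y).mono fun ω h => h.1) hL0))
      simp only [mem_ofPred_eq, not_le] at hω ⊢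
      exact hδδ.trans hω
    rw [h0]
    positivity
  -- for `L ≲ ℓ` the exponent is bounded
  rcases lt_or_ge L (B * ℓ) with hLB | hLB
  · have h1 : δ ^ 2 * (L / ℓ) ^ γ ≤ C := by
      have h2 : L / ℓ ≤ B := by
        rw [div_le_iff₀ hℓ0]
        exact hLB.le
      calc δ ^ 2 * (L / ℓ) ^ γ ≤ δ₀ ^ 2 * B ^ γ := by gcongr
        _ ≤ C := by linarith
    exact measureReal_le_one.trans (one_le_mul_exp_neg (by linarith) h1)
  obtain ⟨R, hR1, hRL, hLR, hRκ, hLH, hmix⟩ := hscale ℓ L hℓ1 hLB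
  have hR0 : 0 < R := by linarith
  set n := ⌈L ^ 2⌉₊ with hn
  set Γ := (L / R) ^ d with hΓ
  have hΓ0 : 0 < Γ := by positivity
  have hRLΓ : (R / L) ^ d = Γ⁻¹ := by rw [hΓ, ← inv_pow, inv_div]
  have herr := approximation_error_le (b := M * (2 ^ d * c)) hκ hc0.le (by positivity) hδ hR1 hL
    (Nat.le_ceil (L ^ 2)) (by rw [hH]; ring) hRκ hLH
  rw [← mul_assoc 2 M, ← hn] at herr
  have hΓL : Γ ≤ L ^ γ := by
    rw [hLR]
    refine (div_le_self (by positivity) (one_le_pow₀ hC₁)).trans ?_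
    exact Real.rpow_le_rpow (by positivity) (div_le_self hL0.le hℓ1) hγ0.le
  have hδΓ : δ * Γ ≤ δ₀ * L ^ γ := by gcongr
  set p := K * (1 + (d * (R * (2 * n)) + R)) ^ K * Real.exp (-((R / 2) ^ β) / K) with hp
  have hp0 : 0 ≤ p := by positivity
  have hpQ : ((2 * n + 1) ^ d : ℕ) * p * Real.exp (δ * Γ) ≤ Q := by
    refine le_trans ?_ (hpref L R hL hR0 hRL)
    rw [hp, mul_assoc, mul_assoc (K * _) (Real.exp _), ← Real.exp_add, ← mul_assoc]
    refine mul_le_mul_of_nonneg_left (Real.exp_le_exp.2 ?_) (by positivity)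
    rw [neg_div]
    linarith
  have hreal := measureReal_lt_spatialAverage_le (l := a * δ * Γ) hd hA hs hf hM0.le hfM
    (hloc (R / 4) (by positivity)) hR0 hRL (by positivity) hp0
    (hα (R / 2) (d * (R * (2 * n)) + R) (by positivity) (by positivity)) hc herr
  rw [hRLΓ, ← hW] at hreal
  have hfinal := hreal.trans (chernoff_optimize hM hW0 hδ hΓ0 (by positivity) ha hpQ)
  have hΓT : a * δ ^ 2 * Γ / 4 = a * (δ ^ 2 * (L / ℓ) ^ γ / C₁ ^ d) / 4 := by
    rw [hLR]
    ring
  rw [hΓT] at hfinal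
  exact hfinal.trans (mul_exp_neg_le_mul_exp_neg ha0 (by positivity) (by positivity)
    (by linarith) (by linarith))

end RandomField

end

theorem proposition1p7 (d : ℕ) (hd : 0 < d) (β : ℝ) (hβ : 0 < β)
    (K κ M : ℝ) (hK : 0 < K) (hκ : 0 < κ) :
    ∃ C : ℝ, 0 < C ∧
      ∀ (Ω : Type*) [MeasurableSpace Ω] (P : Measure Ω) [IsProbabilityMeasure P]
        (A : EuclideanSpace ℝ (Fin d) → Ω → ℝ) (f : (EuclideanSpace ℝ (Fin d) → ℝ) → ℝ),
        -- `A` is a jointly measurable stationary random field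
        Measurable (fun p : EuclideanSpace ℝ (Fin d) × Ω => A p.1 p.2) →
        RandomField.IsStationary P A →
        -- the `α`-mixing condition, or the multiscale covariance inequality
        ((∀ l D : ℝ, 0 ≤ l → 0 ≤ D →
            RandomField.alphaMixingCoeff P A l (ENNReal.ofReal D)
              ≤ K * (1 + D) ^ K * Real.exp (-(l ^ β) / K)) ∨
          (∃ π : ℝ → ℝ, (∀ l : ℝ, 0 ≤ l → π l ≤ K * Real.exp (-(l ^ β) / K)) ∧
            RandomField.OscMCI P A π)) →
        -- `f(A)` is a bounded random variable
        Measurable f →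
        (∀ᵐ ω ∂P, |f (fun x => A x ω)| ≤ M) →
        -- `f(A)` is approximately local
        (∀ l : ℝ, 0 ≤ l → ∀ᵐ ω ∂P,
          |f (fun x => A x ω)
              - (P[fun ω' => f (fun x => A x ω') |
                  RandomField.sigmaRestrict A (Metric.ball 0 l)]) ω|
            ≤ κ * Real.exp (-l / κ)) →
        ∀ δ L : ℝ, 0 < δ → 1 ≤ L →
          P.real {ω | δ < RandomField.spatialAverage P A f L ω} ≤
            C * Real.exp (-(1 / C) *
              (δ ^ 2 * (|Real.log δ| + 1) ^ (-(d * β / (d + β))) * L ^ (d * β / (d + β)))) := by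
  obtain ⟨K', hK', hmci⟩ := RandomField.exists_alphaMixingCoeff_le_of_oscMCI d hβ hK
  obtain ⟨C, hC, hbound⟩ := RandomField.exists_tail_bound_of_mixing (κ := κ) (M := max M 1) hd hβ
    (lt_max_of_lt_left hK : 0 < max K K') hκ (le_max_right _ _)
  refine ⟨C, hC, ?_⟩
  intro Ω _ P _ A f hA hs hmix hf hfM hloc
  refine hbound Ω P A f hA hs (fun l D hl hD => ?_) hf
    (hfM.mono fun ω h => h.trans (le_max_left _ _)) hloc
  -- the mixing rate is monotone in the constant
  have hmono : ∀ K₁ : ℝ, 0 < K₁ → K₁ ≤ max K K' →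
      K₁ * (1 + D) ^ K₁ * Real.exp (-(l ^ β) / K₁)
        ≤ max K K' * (1 + D) ^ (max K K') * Real.exp (-(l ^ β) / max K K') := by
    intro K₁ h0 h1
    have h2 : -(l ^ β) / K₁ ≤ -(l ^ β) / max K K' := by
      rw [neg_div, neg_div, neg_le_neg_iff]
      exact div_le_div_of_nonneg_left (Real.rpow_nonneg hl _) h0 h1
    have h3 : (1 + D) ^ K₁ ≤ (1 + D) ^ (max K K') :=
      Real.rpow_le_rpow_of_exponent_le (by linarith) h1
    have h4 : 0 < max K K' := h0.trans_le h1
    gcongr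
  rcases hmix with h | ⟨π, hπ, h⟩
  · exact (h l D hl hD).trans (hmono K hK (le_max_left _ _))
  · exact (hmci Ω P A (RandomField.measurable_apply_of_joint hA) π hπ h l D hl hD).trans
      (hmono K' hK' (le_max_right _ _))
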